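/- Let $k$ be a field, let $H=\langle 4,7,9\rangle\subseteq\mathbb{N}$ be the numerical semigroup generated by $4,7,9$, and let $A=k[[t^4,t^7,t^9]]=k[[t^h\mid h\in H]]\subseteq k[[t]]$, with maximal ideal $\mathfrak m=(t^4,t^7,t^9)$. Then $A$ is a one-dimensional Cohen--Macaulay local ring which is not Gorenstein. Let $0<s\in H$, and put $Q=(t^s)\subseteq A$ and $I=Q:_A\mathfrak m^2$. Let $\overline Q$ be the integral closure of the ideal $Q$ in $A$, let $\mathrm r_Q(I)=\min\{n\ge 0\mid I^{n+1}=QI^n\}$ be the reduction number of $I$ with respect to $Q$, let $\mathrm G(I)=A[IT,T^{-1}]/T^{-1}A[IT,T^{-1}]$ $(\cong\bigoplus_{n\ge0}I^n/I^{n+1})$ be the associated graded ring of $I$, and let $\mathrm F(I)=A[IT]/\mathfrak m A[IT]$ be its fiber cone, where $T$ is an indeterminate. A Noetherian ring is called Cohen--Macaulay (resp. Buchsbaum) if all its localizations at maximal ideals are Cohen--Macaulay (resp. Buchsbaum) local rings. Then $I\subseteq\overline Q$; if $s\ge 11$, then $I\subseteq\mathfrak m^2$ and $I^2\subseteq Q$.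 Moreover: 1. $\mathrm r_Q(I)=1$ if $s=9$; $\mathrm r_Q(I)=2$ if $s=4$, $s=8$ or $s\ge 11$; and $\mathrm r_Q(I)=3$ if $s=7$. 2. $\mathrm G(I)$ is a Cohen--Macaulay ring if and only if $s\in\{4,8,9\}$. 3. $\mathrm F(I)$ is a Cohen--Macaulay ring if and only if $s\in\{4,9\}$. 4. $\mathrm F(I)$ is always a Buchsbaum ring. 5. $\mathrm G(I)$ is a Buchsbaum ring if and only if $s\ne 7$. 6. $\mathfrak m^2I\ne\mathfrak m^2Q$ if $s=8$ or $s=11$. -/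

import Mathlib

open IsLocalRing

/-! ### Ideals: integral closure, reduction number -/

/-- `x` is integral over the ideal `J`: there is an equation
`x ^ n + a₁ x ^ (n - 1) + ⋯ + aₙ = 0` with `n ≥ 1` and `aᵢ ∈ J ^ i`. -/
def IsIntegralOverIdeal {R : Type*} [CommRing R] (J : Ideal R) (x : R) : Prop :=
  ∃ (n : ℕ) (a : ℕ → R), 0 < n ∧ (∀ i ∈ Finset.Icc 1 n, a i ∈ J ^ i) ∧
    x ^ n + ∑ i ∈ Finset.Icc 1 n, a i * x ^ (n - i) = 0

/-- The integral closure of the ideal `J`, as a set. -/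
def idealIntegralClosure {R : Type*} [CommRing R] (J : Ideal R) : Set R :=
  {x | IsIntegralOverIdeal J x}

/-- `r` is the reduction number `min {n ≥ 0 | I ^ (n + 1) = Q I ^ n}`; in particular that set is
not empty. -/
def IsReductionNumber {R : Type*} [CommRing R] (Q I : Ideal R) (r : ℕ) : Prop :=
  IsLeast {n : ℕ | I ^ (n + 1) = Q * I ^ n} r

/-! ### Blow-up algebras -/

/-- The extended Rees algebra `R[IT, T⁻¹] ⊆ R[T, T⁻¹]`: the Laurent polynomials whose coefficient
of `T ^ n` lies in `I ^ n` for all integers `n`, where `I ^ n = R` for `n ≤ 0`. -/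
def extendedRees {R : Type*} [CommRing R] (I : Ideal R) : Subalgebra R (LaurentPolynomial R) where
  carrier := {f | ∀ n : ℤ, f.coeff n ∈ I ^ n.toNat}
  mul_mem' := by
    intro f g hf hg n
    rw [AddMonoidAlgebra.coeff_mul]
    refine Ideal.sum_mem _ fun a _ => Ideal.sum_mem _ fun b _ => ?_
    dsimp only
    split_ifs with h
    · have hle : n.toNat ≤ a.toNat + b.toNat := by omega
      have hab := Ideal.mul_mem_mul (hf a) (hg b)
      rw [← pow_add] at hab
      exact Ideal.pow_le_pow_right hle hab
    · exact Ideal.zero_mem _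
  add_mem' := by
    intro f g hf hg n
    exact Ideal.add_mem _ (hf n) (hg n)
  algebraMap_mem' := by
    intro r n
    rw [LaurentPolynomial.algebraMap_apply, LaurentPolynomial.C_apply]
    split_ifs with h
    · subst h
      simp
    · exact Ideal.zero_mem _

/-- The element `T⁻¹` of the extended Rees algebra. -/
noncomputable def extendedRees.tInv {R : Type*} [CommRing R] (I : Ideal R) : extendedRees I :=
  ⟨LaurentPolynomial.T (-1), by
    intro n
    rw [LaurentPolynomial.T_apply]
    split_ifs with h
    · subst h
      simp
    · exact Ideal.zero_mem _⟩

/-- The associated graded ring `G(I) = R[IT, T⁻¹] / T⁻¹ R[IT, T⁻¹]`. -/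
abbrev AssocGradedRing {R : Type*} [CommRing R] (I : Ideal R) : Type _ :=
  extendedRees I ⧸ Ideal.span {extendedRees.tInv I}

/-- The fiber cone `F(I) = R[IT] / 𝔪 R[IT]` of an ideal of a local ring `(R, 𝔪)`. -/
abbrev FiberCone {R : Type*} [CommRing R] [IsLocalRing R] (I : Ideal R) : Type _ :=
  reesAlgebra I ⧸ (maximalIdeal R).map (algebraMap R (reesAlgebra I))

/-! ### Cohen-Macaulay, Buchsbaum and Gorenstein rings -/

/-- A Noetherian local ring is Cohen-Macaulay if its maximal ideal contains a regular sequence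
whose length is the dimension of the ring (that is, if its depth equals its dimension). -/
def IsCohenMacaulayLocal (R : Type*) [CommRing R] [IsLocalRing R] : Prop :=
  IsNoetherianRing R ∧ ∃ rs : List R, (∀ r ∈ rs, r ∈ maximalIdeal R) ∧
    RingTheory.Sequence.IsRegular R rs ∧ (rs.length : WithBot ℕ∞) = ringKrullDim R

/-- A Noetherian ring is Cohen-Macaulay if its localizations at all maximal ideals are. -/
def IsCohenMacaulayRing (R : Type*) [CommRing R] : Prop :=
  IsNoetherianRing R ∧ ∀ (M : Ideal R) [M.IsMaximal],
    IsCohenMacaulayLocal (Localization.AtPrime M)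

/-- `a₁, …, a_d` is a system of parameters of the local ring `R`: `d = dim R` and the ideal
generated by `a₁, …, a_d` is primary to the maximal ideal. -/
def IsSystemOfParameters {R : Type*} [CommRing R] [IsLocalRing R] (rs : List R) : Prop :=
  (rs.length : WithBot ℕ∞) = ringKrullDim R ∧ (Ideal.ofList rs).radical = maximalIdeal R

/-- A Noetherian local ring `(R, 𝔪)` is Buchsbaum if every system of parameters `a₁, …, a_d` is a
weak sequence: `(a₁, …, aᵢ) : aᵢ₊₁ = (a₁, …, aᵢ) : 𝔪` for all `0 ≤ i < d`. -/
def IsBuchsbaumLocal (R : Type*) [CommRing R] [IsLocalRing R] : Prop :=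
  IsNoetherianRing R ∧ ∀ rs : List R, IsSystemOfParameters rs → ∀ i : Fin rs.length,
    (Ideal.ofList (rs.take i)).colon {rs[i]} =
      (Ideal.ofList (rs.take i)).colon (maximalIdeal R : Set R)

/-- A Noetherian ring is Buchsbaum if its localizations at all maximal ideals are. -/
def IsBuchsbaumRing (R : Type*) [CommRing R] : Prop :=
  IsNoetherianRing R ∧ ∀ (M : Ideal R) [M.IsMaximal],
    IsBuchsbaumLocal (Localization.AtPrime M)

/-- A Noetherian local ring is Gorenstein if it has finite injective dimension as a module over
itself. -/
def IsGorensteinLocal (R : Type*) [CommRing R] [IsLocalRing R] : Prop :=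
  IsNoetherianRing R ∧ ∃ n : ℕ, CategoryTheory.HasInjectiveDimensionLT (ModuleCat.of R R) n

/-! ### Semigroup rings -/

/-- The semigroup ring `k[[H]] = k[[t ^ h | h ∈ H]] ⊆ k[[t]]` of a submonoid `H` of `ℕ`: the power
series `∑ cₕ t ^ h`, where `h` runs through `H`. -/
def semigroupRing (k : Type*) [Field k] (H : AddSubmonoid ℕ) : Subalgebra k (PowerSeries k) where
  carrier := {f | ∀ n, n ∉ H → PowerSeries.coeff n f = 0}
  mul_mem' := by
    intro f g hf hg n hn
    rw [PowerSeries.coeff_mul]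
    refine Finset.sum_eq_zero fun p hp => ?_
    rw [Finset.HasAntidiagonal.mem_antidiagonal] at hp
    by_cases h1 : p.1 ∈ H
    · by_cases h2 : p.2 ∈ H
      · exact absurd (hp ▸ H.add_mem h1 h2) hn
      · rw [hg _ h2, mul_zero]
    · rw [hf _ h1, zero_mul]
  add_mem' := by
    intro f g hf hg n hn
    rw [map_add, hf n hn, hg n hn, add_zero]
  algebraMap_mem' := by
    intro c n hn
    rw [PowerSeries.algebraMap_apply, PowerSeries.coeff_C, if_neg]
    rintro rfl
    exact hn H.zero_mem

/-- A power series in `k[[H]]` with nonzero constant term is a unit of `k[[H]]`. -/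
theorem semigroupRing.isUnit_of_constantCoeff_ne_zero {k : Type*} [Field k] {H : AddSubmonoid ℕ}
    (f : semigroupRing k H) (hf : PowerSeries.constantCoeff (f : PowerSeries k) ≠ 0) :
    IsUnit f := by
  have key : ∀ n, n ∉ H → PowerSeries.coeff n (f : PowerSeries k)⁻¹ = 0 := by
    intro n
    induction n using Nat.strong_induction_on with
    | _ n ih =>
      intro hn
      have h0 : n ≠ 0 := by
        rintro rfl
        exact hn H.zero_mem
      rw [PowerSeries.coeff_inv, if_neg h0, Finset.sum_eq_zero, mul_zero]
      intro p hp
      rw [Finset.HasAntidiagonal.mem_antidiagonal] at hp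
      split_ifs with hlt
      · by_cases h1 : p.1 ∈ H
        · by_cases h2 : p.2 ∈ H
          · exact absurd (hp ▸ H.add_mem h1 h2) hn
          · rw [ih _ hlt h2, mul_zero]
        · rw [f.2 _ h1, zero_mul]
      · rfl
  exact IsUnit.of_mul_eq_one (⟨(f : PowerSeries k)⁻¹, key⟩ : semigroupRing k H)
    (Subtype.ext (PowerSeries.mul_inv_cancel _ hf))

instance semigroupRing.instIsLocalRing (k : Type*) [Field k] (H : AddSubmonoid ℕ) :
    IsLocalRing (semigroupRing k H) := by
  refine IsLocalRing.of_isUnit_or_isUnit_one_sub_self fun f => ?_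
  by_cases hf : PowerSeries.constantCoeff (f : PowerSeries k) = 0
  · right
    apply semigroupRing.isUnit_of_constantCoeff_ne_zero
    simp [hf]
  · left
    exact semigroupRing.isUnit_of_constantCoeff_ne_zero f hf

/-- The element `t ^ s` of `k[[H]]`, for `s ∈ H`. -/
noncomputable def semigroupRing.tPow (k : Type*) [Field k] {H : AddSubmonoid ℕ} (s : ℕ)
    (hs : s ∈ H) : semigroupRing k H :=
  ⟨PowerSeries.X ^ s, by
    intro n hn
    rw [PowerSeries.coeff_X_pow, if_neg]
    rintro rfl
    exact hn hs⟩

/-- The numerical semigroup `⟨4, 7, 9⟩`. -/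
def semigroup479 : AddSubmonoid ℕ := AddSubmonoid.closure {4, 7, 9}

/-- The ring `k[[t ^ 4, t ^ 7, t ^ 9]] ⊆ k[[t]]`. -/
abbrev Ring479 (k : Type*) [Field k] : Type _ := semigroupRing k semigroup479

open IsLocalRing

/-! ### Local rings of dimension at most one -/

/-! Everything is monomial. Here H = {0, 4, 7, 8, 9, 11, 12, …}, and I = Q : 𝔪² is generated by the
t^n with n ∈ H, n ≥ s, n ≠ s + 2 (`Ring479.colon_eq`). The ideals Iⁿ and 𝔪Iⁿ are likewise described
by explicit sets of exponents (`Ring479.pow_eq`, `Ring479.pow_eq'`,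
`Ring479.isMonomialFiltration_maximalIdeal'`), so the reduction numbers and the ideal inequalities
become arithmetic of exponents.

For the blow-up algebras, G(I) and F(I) are both quotients R = A[IT]/J A[IT], with J = I or J = 𝔪
(`IsReesQuotient`). Since k[[t]] is integral over A, every element of I is integral over Q, so R is
integral over the image of k[X] under X ↦ t^s T and has dimension at most one. Four criteria in
terms of k[X]-torsion decide everything: R is Cohen–Macaulay if there is no torsion, and not if
there is a nonzero homogeneous class killed by the graded maximal ideal M; R is Buchsbaum if M kills
all torsion, and not if some element of M takes a homogeneous torsion class to a nonzero class.
Torsion can be tested on homogeneous elements (`IsReesQuotient.exists_pow_mul_coeff_mem`), hence on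
exponents.

A is not Gorenstein because t^9 and t^14 are both socle elements of A/(t^4). The residue field is a
direct summand of 𝔪/(t^4) through t^9, so finite injective dimension would force Ext²(k, A) = 0;
then every map 𝔪/(t^4) → A/(t^4) would extend to A/(t^4), which fails for the map "coefficient of
t^9, times t^14" (`not_hasInjectiveDimensionLT`). -/

theorem isCohenMacaulayLocal_of_krullDimLE_one {R : Type*} [CommRing R] [IsLocalRing R]
    [IsNoetherianRing R] [Ring.KrullDimLE 1 R] {a : R} (ha : a ∈ maximalIdeal R)
    (hreg : IsSMulRegular R a) : IsCohenMacaulayLocal R := by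
  refine ⟨inferInstance, [a], by simpa using ha, ?_, ?_⟩
  · refine RingTheory.Sequence.IsRegular.of_isWeaklyRegular_of_mem_maximalIdeal R
      (by simpa using (mem_maximalIdeal a).1 ha) ?_
    exact (RingTheory.Sequence.isWeaklyRegular_singleton_iff R a).2 hreg
  · refine le_antisymm ?_ (Ring.krullDimLE_iff.1 ‹_›)
    have h := ringKrullDim_quotient_succ_le_of_nonZeroDivisor (r := a) (by
      rw [mem_nonZeroDivisors_iff_right]
      intro x hx
      exact hreg (by simpa [mul_comm] using hx))
    have : Nontrivial (R ⧸ Ideal.span {a}) := Ideal.Quotient.nontrivial_iff.2 fun h =>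
      (Ideal.span_singleton_eq_top.1 h |> (mem_maximalIdeal a).1 ha)
    have h0 := ringKrullDim_nonneg_of_nontrivial (R := R ⧸ Ideal.span {a})
    calc ((([a] : List R).length : ℕ) : WithBot ℕ∞) = 0 + 1 := by simp
      _ ≤ _ := by gcongr
      _ ≤ _ := h

theorem not_krullDimLE_zero_of_not_isNilpotent {R : Type*} [CommRing R] [IsLocalRing R] {a : R}
    (ha : a ∈ maximalIdeal R) (hnil : ¬ IsNilpotent a) : ¬ Ring.KrullDimLE 0 R := by
  intro h
  have hmem : a ∈ Ring.jacobson R := by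
    rw [IsLocalRing.ringJacobson_eq_maximalIdeal]
    exact ha
  rw [Ring.jacobson_eq_nilradical_of_krullDimLE_zero] at hmem
  exact hnil hmem

/-- The first member of a nonempty regular sequence in 𝔪 would kill z; an empty one would force
dimension zero, where 𝔪 is nil. -/
theorem not_isCohenMacaulayLocal_of_socle {R : Type*} [CommRing R] [IsLocalRing R] {a z : R}
    (ha : a ∈ maximalIdeal R) (hnil : ¬ IsNilpotent a) (hz : z ≠ 0)
    (hsoc : ∀ g ∈ maximalIdeal R, g * z = 0) : ¬ IsCohenMacaulayLocal R := by
  rintro ⟨-, rs, hmem, hreg, hlen⟩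
  cases rs with
  | nil =>
    refine not_krullDimLE_zero_of_not_isNilpotent ha hnil (Ring.krullDimLE_iff.2 ?_)
    rw [← hlen]
    simp
  | cons r rs =>
    have h := ((RingTheory.Sequence.isRegular_cons_iff R r rs).1 hreg).1
    refine hz (h ?_)
    simpa using hsoc r (hmem r (by simp))

/-- In dimension at most one the definition reduces to 0 : a = 0 : 𝔪 for a single parameter a, and
one inclusion is automatic since a ∈ 𝔪. -/
theorem isBuchsbaumLocal_of_krullDimLE_one {R : Type*} [CommRing R] [IsLocalRing R]
    [IsNoetherianRing R] [Ring.KrullDimLE 1 R]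
    (h : ∀ a : R, (Ideal.span {a}).radical = maximalIdeal R → ∀ y, a * y = 0 →
      ∀ g ∈ maximalIdeal R, g * y = 0) : IsBuchsbaumLocal R := by
  refine ⟨inferInstance, fun rs hrs i => ?_⟩
  obtain ⟨hlen, hrad⟩ := hrs
  have hle : (rs.length : WithBot ℕ∞) ≤ (1 : ℕ) := hlen ▸ Ring.krullDimLE_iff.1 ‹_›
  have hle' : rs.length ≤ 1 := by exact_mod_cast hle
  -- The empty list has no index `i`, so only lists of length one remain.
  match rs, i, hle', hrad with
  | [a], ⟨0, _⟩, _, hrad =>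
    rw [Ideal.ofList_singleton] at hrad
    have ha : a ∈ maximalIdeal R := hrad ▸ Ideal.le_radical (Ideal.mem_span_singleton_self a)
    ext y
    simp only [List.take_zero, Ideal.ofList_nil, Submodule.mem_colon]
    constructor
    · intro hy g hg
      have := h a hrad y (by simpa [mul_comm] using hy a (by simp)) g hg
      simpa [mul_comm] using this
    · intro hy g hg
      obtain rfl : g = a := by simpa using hg
      exact hy g ha

theorem not_isBuchsbaumLocal {R : Type*} [CommRing R] [IsLocalRing R]
    [Ring.KrullDimLE 1 R] {a g z : R} (hrad : (Ideal.span {a}).radical = maximalIdeal R)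
    (hnil : ¬ IsNilpotent a) (haz : a * z = 0) (hg : g ∈ maximalIdeal R) (hgz : g * z ≠ 0) :
    ¬ IsBuchsbaumLocal R := by
  rintro ⟨-, h⟩
  have ha : a ∈ maximalIdeal R := hrad ▸ Ideal.le_radical (Ideal.mem_span_singleton_self a)
  have hdim : ringKrullDim R = 1 := by
    have h0 : ¬ ringKrullDim R ≤ 0 := fun hle =>
      not_krullDimLE_zero_of_not_isNilpotent ha hnil (Ring.krullDimLE_iff.2 hle)
    exact le_antisymm (Ring.krullDimLE_iff.1 ‹_›) (Order.succ_le_of_lt (lt_of_not_ge h0))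
  have key := h [a] ⟨by simp [hdim], by rwa [Ideal.ofList_singleton]⟩ ⟨0, by simp⟩
  have hz : z ∈ (Ideal.ofList (([a] : List R).take 0)).colon {a} := by
    simp only [List.take_zero, Ideal.ofList_nil, Submodule.mem_colon]
    intro b hb
    obtain rfl : b = a := by simpa using hb
    simpa [mul_comm] using haz
  have hz' : z ∈ (Ideal.ofList (([a] : List R).take 0)).colon (maximalIdeal R : Set R) := key ▸ hz
  simp only [List.take_zero, Ideal.ofList_nil, Submodule.mem_colon] at hz'
  exact hgz (by simpa [mul_comm] using hz' g hg)

/-! ### Integral algebras over a principal ideal domain -/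

/-- By incomparability a prime strictly above a minimal one contracts to a nonzero prime of B. That
contraction is maximal, and maximality lifts along integral extensions. -/
theorem krullDimLE_one_of_isIntegral (B R : Type*) [CommRing B] [IsDomain B]
    [IsPrincipalIdealRing B] [CommRing R] [Algebra B R] [Algebra.IsIntegral B R] : Ring.KrullDimLE 1 R := by
  refine .mk₁ fun P hP => ?_
  obtain ⟨P₀, hP₀, hle⟩ := Ideal.exists_minimalPrimes_le (J := P) bot_le
  rcases eq_or_lt_of_le hle with h | h
  · exact .inl (h ▸ hP₀)
  · right
    have := hP₀.1.1
    have hlt := Ideal.IsIntegral.comap_lt_comap (R := B) h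
    refine Ideal.IsIntegral.isMaximal_of_isMaximal_comap (R := B) P ?_
    exact IsPrime.to_maximal_ideal (bot_lt_iff_ne_bot.1 (bot_le.trans_lt hlt))

theorem krullDimLE_one_localization (B : Type*) {R : Type*} [CommRing B] [IsDomain B]
    [IsPrincipalIdealRing B] [CommRing R] [Algebra B R] [Algebra.IsIntegral B R]
    (N : Ideal R) [N.IsPrime] :
    Ring.KrullDimLE 1 (Localization.AtPrime N) := by
  have h1 := Ring.krullDimLE_iff.1 (krullDimLE_one_of_isIntegral B R)
  refine Ring.krullDimLE_iff.2 ?_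
  rw [IsLocalization.AtPrime.ringKrullDim_eq_height N (Localization.AtPrime N)]
  exact (Ideal.height_le_ringKrullDim_of_ne_top Ideal.IsPrime.ne_top').trans h1

theorem exists_ne_zero_algebraMap_mem {B R : Type*} [CommRing B] [IsDomain B] [CommRing R]
    [Algebra B R] [Algebra.IsIntegral B R] (hB : ¬ IsField B) (N : Ideal R) [N.IsMaximal] :
    ∃ p : B, p ≠ 0 ∧ algebraMap B R p ∈ N := by
  have hmax := Ideal.isMaximal_comap_of_isIntegral_of_isMaximal (R := B) N
  have hne : N.comap (algebraMap B R) ≠ ⊥ := Ring.ne_bot_of_isMaximal_of_not_isField hmax hB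
  obtain ⟨p, hp, hp0⟩ := Submodule.exists_mem_ne_zero_of_ne_bot hne
  exact ⟨p, hp0, hp⟩

section IntegralOverPID

variable {B R : Type*} [CommRing B] [IsDomain B] [IsPrincipalIdealRing B] [CommRing R]
  [Algebra B R] [Algebra.IsIntegral B R]

/-- Every maximal ideal N lies over a nonzero p ∈ B, which torsion-freeness makes regular in the
localization at N. -/
theorem isCohenMacaulayRing_of_isIntegral [IsNoetherianRing R] (hB : ¬ IsField B)
    (h : ∀ (p : B) (y : R), p ≠ 0 → algebraMap B R p * y = 0 → y = 0) :
    IsCohenMacaulayRing R := by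
  refine ⟨inferInstance, fun N _ => ?_⟩
  obtain ⟨p, hp0, hp⟩ := exists_ne_zero_algebraMap_mem hB N
  have := krullDimLE_one_localization B N
  refine isCohenMacaulayLocal_of_krullDimLE_one
    (a := algebraMap R (Localization.AtPrime N) (algebraMap B R p)) ?_ ?_
  · exact (IsLocalization.AtPrime.to_map_mem_maximal_iff _ N _).2 hp
  · have hreg : IsSMulRegular R (algebraMap B R p) := by
      refine isSMulRegular_iff_right_eq_zero_of_smul.2 fun y hy => h p y hp0 hy
    refine isSMulRegular_iff_right_eq_zero_of_smul.2 fun y hy => ?_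
    obtain ⟨w, u, rfl⟩ := IsLocalization.exists_mk'_eq N.primeCompl y
    rw [smul_eq_mul, ← IsLocalization.mk'_one (M := N.primeCompl) (Localization.AtPrime N),
      ← IsLocalization.mk'_mul, IsLocalization.mk'_eq_zero_iff] at hy
    obtain ⟨v, hv⟩ := hy
    rw [IsLocalization.mk'_eq_zero_iff]
    exact ⟨v, h p _ hp0 (by linear_combination hv)⟩

/-- At M the torsion is killed by the maximal ideal. At any other N, an element of M outside N
becomes a unit that kills the torsion, so the localization is torsion-free. -/
theorem isBuchsbaumRing_of_isIntegral [IsNoetherianRing R] (hB : ¬ IsField B) (M : Ideal R)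
    [hM : M.IsMaximal]
    (h : ∀ (p : B) (y : R), p ≠ 0 → algebraMap B R p * y = 0 → ∀ g ∈ M, g * y = 0) :
    IsBuchsbaumRing R := by
  refine ⟨inferInstance, fun N hN => ?_⟩
  obtain ⟨p, hp0, hp⟩ := exists_ne_zero_algebraMap_mem hB N
  have := krullDimLE_one_localization B N
  refine isBuchsbaumLocal_of_krullDimLE_one fun a ha y hay => ?_
  have hpm : algebraMap R (Localization.AtPrime N) (algebraMap B R p) ∈ maximalIdeal _ :=
    (IsLocalization.AtPrime.to_map_mem_maximal_iff _ N _).2 hp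
  rw [← ha] at hpm
  -- A power of p is a multiple of the parameter a, so whatever a kills is B-torsion.
  obtain ⟨n, hn⟩ := hpm
  obtain ⟨c, hc⟩ := Ideal.mem_span_singleton'.1 hn
  obtain ⟨w, u, rfl⟩ := IsLocalization.exists_mk'_eq N.primeCompl y
  have hy : algebraMap R (Localization.AtPrime N) (algebraMap B R p ^ n) *
      IsLocalization.mk' (Localization.AtPrime N) w u = 0 := by
    rw [map_pow, ← hc, mul_assoc, hay, mul_zero]
  rw [← IsLocalization.mk'_one (M := N.primeCompl) (Localization.AtPrime N),
      ← IsLocalization.mk'_mul, IsLocalization.mk'_eq_zero_iff] at hy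
  obtain ⟨v, hv⟩ := hy
  have htors : ∀ g ∈ M, g * (v * w) = 0 :=
    h (p ^ n) (v * w) (pow_ne_zero n hp0) (by rw [map_pow]; linear_combination hv)
  intro g hg
  by_cases hMN : M = N
  · subst hMN
    obtain ⟨b, q, rfl⟩ := IsLocalization.exists_mk'_eq M.primeCompl g
    have hb := (IsLocalization.AtPrime.mk'_mem_maximal_iff (Localization.AtPrime M) M b q).1 hg
    rw [← IsLocalization.mk'_mul, IsLocalization.mk'_eq_zero_iff]
    exact ⟨v, by linear_combination htors b hb⟩
  · have hnle : ¬ M ≤ N := fun hle => hMN (hM.eq_of_le hN.ne_top hle)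
    obtain ⟨b, hbM, hbN⟩ := SetLike.not_le_iff_exists.1 hnle
    have : IsLocalization.mk' (Localization.AtPrime N) w u = 0 := by
      rw [IsLocalization.mk'_eq_zero_iff]
      exact ⟨⟨b, hbN⟩ * v, by simpa [mul_assoc] using htors b hbM⟩
    rw [this, mul_zero]

theorem not_isNilpotent_algebraMap_localization {R : Type*} [CommRing R] (M : Ideal R)
    [M.IsPrime] {f : R} (h : ∀ n, ∀ u ∉ M, u * f ^ n ≠ 0) :
    ¬ IsNilpotent (algebraMap R (Localization.AtPrime M) f) := by
  rintro ⟨n, hn⟩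
  rw [← map_pow, IsLocalization.map_eq_zero_iff M.primeCompl] at hn
  obtain ⟨u, hu⟩ := hn
  exact h n u u.2 hu

theorem not_isCohenMacaulayRing_of_socle {R : Type*} [CommRing R] (M : Ideal R) [M.IsMaximal]
    {f z : R} (hf : f ∈ M) (hnil : ∀ n, ∀ u ∉ M, u * f ^ n ≠ 0)
    (hz : ∀ u ∉ M, u * z ≠ 0) (hsoc : ∀ g ∈ M, g * z = 0) : ¬ IsCohenMacaulayRing R := by
  rintro ⟨-, h⟩
  refine not_isCohenMacaulayLocal_of_socle (z := algebraMap R (Localization.AtPrime M) z)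
    ((IsLocalization.AtPrime.to_map_mem_maximal_iff _ M _).2 hf)
    (not_isNilpotent_algebraMap_localization M hnil) ?_ ?_ (h M)
  · intro h0
    rw [IsLocalization.map_eq_zero_iff M.primeCompl] at h0
    obtain ⟨u, hu⟩ := h0
    exact hz u u.2 hu
  · intro g hg
    obtain ⟨b, q, rfl⟩ := IsLocalization.exists_mk'_eq M.primeCompl g
    have hb := (IsLocalization.AtPrime.mk'_mem_maximal_iff (Localization.AtPrime M) M b q).1 hg
    rw [← IsLocalization.mk'_one (M := M.primeCompl) (Localization.AtPrime M),
      ← IsLocalization.mk'_mul, hsoc b hb, IsLocalization.mk'_zero]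

/-- The power p^j is a parameter at M: a prime containing p contracts to a nonzero, hence maximal,
ideal of B. It kills z while g ∈ M does not. -/
theorem not_isBuchsbaumRing_of_isIntegral (M : Ideal R) [hM : M.IsMaximal] {p : B} {z g : R}
    (hp : Irreducible p) (hpM : algebraMap B R p ∈ M)
    (hnil : ∀ n, ∀ u ∉ M, u * algebraMap B R p ^ n ≠ 0) {j : ℕ} (hj : j ≠ 0)
    (hpz : algebraMap B R p ^ j * z = 0) (hg : g ∈ M) (hgz : ∀ u ∉ M, u * (g * z) ≠ 0) :
    ¬ IsBuchsbaumRing R := by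
  rintro ⟨-, h⟩
  have := krullDimLE_one_localization B M
  set ι := algebraMap R (Localization.AtPrime M)
  have hnil' := not_isNilpotent_algebraMap_localization M hnil
  have hpm : ι (algebraMap B R p) ∈ maximalIdeal _ :=
    (IsLocalization.AtPrime.to_map_mem_maximal_iff _ M _).2 hpM
  refine not_isBuchsbaumLocal (a := ι (algebraMap B R p) ^ j) (z := ι z) (g := ι g) ?_ ?_ ?_
    ((IsLocalization.AtPrime.to_map_mem_maximal_iff _ M _).2 hg) ?_ (h M)
  · rw [← Ideal.span_singleton_pow, Ideal.radical_pow _ hj, Ideal.radical_eq_sInf]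
    refine le_antisymm (sInf_le ⟨by simpa [Ideal.span_le] using hpm, inferInstance⟩) ?_
    refine le_sInf fun P ⟨hP1, hP2⟩ => ?_
    have hmem : algebraMap B R p ∈ P.comap ι := hP1 (Ideal.mem_span_singleton_self _)
    have hPp : (P.comap ι).IsPrime := hP2.comap _
    have hcm : (P.comap ι).IsMaximal := by
      refine Ideal.IsIntegral.isMaximal_of_isMaximal_comap (R := B) _ ?_
      have := hPp.comap (algebraMap B R)
      refine IsPrime.to_maximal_ideal ?_
      exact fun hb => hp.ne_zero (by simpa using hb.le (show p ∈ _ from hmem))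
    have hle : P.comap ι ≤ M := by
      intro x hx
      exact (IsLocalization.AtPrime.to_map_mem_maximal_iff _ M _).1 (le_maximalIdeal hP2.ne_top hx)
    have heq := hcm.eq_of_le hM.ne_top hle
    rw [← IsLocalization.map_under M.primeCompl (Localization.AtPrime M) P,
      ← Localization.AtPrime.map_eq_maximalIdeal]
    exact (congrArg (Ideal.map ι) heq).ge
  · exact fun hn => hnil' ((hn.of_pow))
  · rw [← map_pow, ← map_mul, hpz, map_zero]
  · rw [← map_mul]
    intro h0
    rw [IsLocalization.map_eq_zero_iff M.primeCompl] at h0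
    obtain ⟨u, hu⟩ := h0
    exact hgz u u.2 hu

end IntegralOverPID

/-! ### Quotients of Rees algebras by extended ideals -/

section ReesQuotient

open Polynomial

/-- The ring homomorphism `k[X] → A[IT]` that sends `X` to `xT`. -/
noncomputable def reesParam (k : Type*) {A : Type*} [Field k] [CommRing A] [Algebra k A]
    {I : Ideal A} {x : A} (hx : x ∈ I) : k[X] →+* reesAlgebra I :=
  ((compRingHom (C x * X)).comp (mapRingHom (algebraMap k A))).codRestrict (reesAlgebra I)
    fun p i => by
      simp only [RingHom.comp_apply, coe_compRingHom, coe_mapRingHom, comp_C_mul_X_coeff]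
      exact Ideal.mul_mem_left _ _ (Ideal.pow_mem_pow hx i)

theorem coeff_reesParam {k A : Type*} [Field k] [CommRing A] [Algebra k A]
    {I : Ideal A} {x : A} (hx : x ∈ I) (p : k[X]) (n : ℕ) :
    (reesParam k hx p : A[X]).coeff n = algebraMap k A (p.coeff n) * x ^ n := by
  change ((p.map (algebraMap k A)).comp (C x * X)).coeff n = _
  rw [comp_C_mul_X_coeff, coeff_map]

/-- The homomorphism `A[IT] → A` that takes the coefficient of degree zero. -/
noncomputable def reesConstantCoeff {A : Type*} [CommRing A] (I : Ideal A) :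
    reesAlgebra I →+* A :=
  constantCoeff.comp (reesAlgebra I).val.toRingHom

theorem reesConstantCoeff_apply {A : Type*} [CommRing A] (I : Ideal A) (p : reesAlgebra I) :
    reesConstantCoeff I p = (p : A[X]).coeff 0 := rfl

/-- The homogeneous element `a T ^ n` of the Rees algebra. -/
noncomputable def reesMonomial {A : Type*} [CommRing A] {I : Ideal A} (n : ℕ) (a : A)
    (ha : a ∈ I ^ n) : reesAlgebra I :=
  ⟨monomial n a, reesAlgebra.monomial_mem.2 ha⟩

theorem coeff_reesMonomial {A : Type*} [CommRing A] {I : Ideal A} (n i : ℕ) (a : A)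
    (ha : a ∈ I ^ n) :
    (reesMonomial n a ha : A[X]).coeff i = if n = i then a else 0 := coeff_monomial

/-- Reduces annihilation by all elements of positive degree in the Rees algebra to annihilation by
those of degree one. -/
theorem mul_mem_pow_mul_of_forall {A : Type*} [CommRing A] {I K : Ideal A} {y : A}
    (h : ∀ a ∈ I, a * y ∈ K) (n : ℕ) {a : A} (ha : a ∈ I ^ (n + 1)) : a * y ∈ I ^ n * K := by
  rw [pow_succ] at ha
  refine Submodule.mul_induction_on ha (fun b hb c hc => ?_) (fun b c hb hc => ?_)
  · rw [mul_assoc]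
    exact Ideal.mul_mem_mul hb (h c hc)
  · rw [add_mul]
    exact add_mem hb hc

/-- `φ` presents `R` as the quotient `A[IT] / J A[IT]` of the Rees algebra of an ideal `I` of a
local `k`-algebra `A` with residue field `k`, where `J` is primary to the maximal ideal and `x`
generates a reduction of `I`. -/
structure IsReesQuotient (k : Type*) {A R : Type*} [Field k] [CommRing A] [IsLocalRing A]
    [Algebra k A] [CommRing R] (I J : Ideal A) (x : A) (φ : reesAlgebra I →+* R) : Prop where
  mem : x ∈ I
  surjective : Function.Surjective φ
  map_eq_zero_iff : ∀ p, φ p = 0 ↔ ∀ n, (p : A[X]).coeff n ∈ J * I ^ n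
  le : J ≤ maximalIdeal A
  exists_pow_mem : ∀ a ∈ maximalIdeal A, ∃ n, a ^ n ∈ J
  exists_sub_mem : ∀ a : A, ∃ c : k, a - algebraMap k A c ∈ maximalIdeal A
  isIntegralOverIdeal : ∀ a ∈ I, IsIntegralOverIdeal (Ideal.span {x}) a
  pow_notMem : ∀ n, x ^ n ∉ J * I ^ n

namespace IsReesQuotient

variable {k A R : Type*} [Field k] [CommRing A] [IsLocalRing A] [Algebra k A] [CommRing R]
  {I J : Ideal A} {x : A} {φ : reesAlgebra I →+* R}

/-- It suffices to treat the generators. An element of A differs from a constant of k by an element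
that is nilpotent modulo J; an element aT with a ∈ I satisfies the equation of integrality of a over
(x), made homogeneous. -/
theorem isIntegral (h : IsReesQuotient k I J x φ) :
    (φ.comp (reesParam k h.mem)).IsIntegral := by
  set ψ := φ.comp (reesParam k h.mem) with hψ
  have hC : ∀ a : A, ψ.IsIntegralElem (φ (algebraMap A (reesAlgebra I) a)) := by
    intro a
    obtain ⟨c, hc⟩ := h.exists_sub_mem a
    obtain ⟨n, hn⟩ := h.exists_pow_mem _ hc
    have h1 : ψ.IsIntegralElem (φ (algebraMap A (reesAlgebra I) (a - algebraMap k A c))) := by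
      refine ⟨X ^ n, monic_X_pow n, ?_⟩
      rw [eval₂_X_pow, ← map_pow, ← map_pow, h.map_eq_zero_iff]
      intro i
      change (C _).coeff i ∈ _
      rw [coeff_C]
      split_ifs with hi
      · simpa [hi] using hn
      · exact zero_mem _
    have h2 : φ (algebraMap A (reesAlgebra I) (algebraMap k A c)) = ψ (C c) := by
      rw [hψ, RingHom.comp_apply]
      congr 1
      apply Subtype.ext
      ext i
      rw [coeff_reesParam]
      change (C _).coeff i = _
      rw [coeff_C, coeff_C]
      split_ifs with hi
      · simp [hi]
      · simp
    have h3 := h1.add ψ (ψ.isIntegralElem_map (x := C c))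
    rwa [← h2, ← map_add, ← map_add, sub_add_cancel] at h3
  have hmon : ∀ (a : A) (ha : a ∈ I ^ 1), ψ.IsIntegralElem (φ (reesMonomial 1 a ha)) := by
    intro a ha
    obtain ⟨n, c, hn, hc, heq⟩ := h.isIntegralOverIdeal a (by simpa using ha)
    have hd : ∀ i, ∃ d : A, i ∈ Finset.Icc 1 n → c i = d * x ^ i := by
      intro i
      by_cases hi : i ∈ Finset.Icc 1 n
      · have := hc i hi
        rw [Ideal.span_singleton_pow, Ideal.mem_span_singleton'] at this
        obtain ⟨d, hd⟩ := this
        exact ⟨d, fun _ => hd.symm⟩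
      · exact ⟨0, fun h => absurd h hi⟩
    -- The i-th coefficient is d_i x^i, so in degree i it becomes d_i (xT)^i, which is integral over
    -- k[X] by the degree-zero case; transitivity of integrality finishes.
    choose d hd using hd
    let _ := ψ.toAlgebra
    let S := integralClosure k[X] R
    have hb : ∀ i, φ (algebraMap A (reesAlgebra I) (d i)) * ψ X ^ i ∈ S := fun i =>
      mul_mem (hC (d i)) (pow_mem (ψ.isIntegralElem_map (x := X)) i)
    change IsIntegral k[X] _
    refine isIntegral_trans (A := S) _ ?_
    refine ⟨X ^ n + ∑ i ∈ Finset.Icc 1 n, C ⟨_, hb i⟩ * X ^ (n - i), ?_, ?_⟩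
    · refine monic_X_pow_add ?_
      refine (degree_sum_le _ _).trans_lt ?_
      rw [Finset.sup_lt_iff (by exact_mod_cast WithBot.bot_lt_coe n)]
      intro i hi
      rw [Finset.mem_Icc] at hi
      refine (degree_C_mul_X_pow_le _ _).trans_lt ?_
      exact_mod_cast (by omega : n - i < n)
    · rw [eval₂_add, eval₂_X_pow, eval₂_finsetSum]
      simp only [eval₂_mul, eval₂_C, eval₂_X_pow]
      change φ (reesMonomial 1 a ha) ^ n + ∑ i ∈ Finset.Icc 1 n,
        φ (algebraMap A (reesAlgebra I) (d i)) * φ (reesParam k h.mem X) ^ i *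
          φ (reesMonomial 1 a ha) ^ (n - i) = 0
      simp only [← map_pow, ← map_mul, ← map_sum, ← map_add]
      rw [← map_zero φ]
      congr 1
      apply Subtype.ext
      have hX : ∀ i, (reesParam k h.mem (X ^ i) : A[X]) = monomial i (x ^ i) := by
        intro i
        ext l
        rw [coeff_reesParam, coeff_X_pow, coeff_monomial]
        by_cases hi : i = l
        · simp [hi]
        · simp [hi, Ne.symm hi]
      simp only [AddMemClass.coe_add, AddSubmonoidClass.coe_finsetSum, MulMemClass.coe_mul,
        SubmonoidClass.coe_pow, hX, ZeroMemClass.coe_zero]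
      change (monomial 1 a : A[X]) ^ n + ∑ i ∈ Finset.Icc 1 n,
        C (d i) * monomial i (x ^ i) * monomial 1 a ^ (n - i) = 0
      have h1 : ∀ i ∈ Finset.Icc 1 n, C (d i) * (monomial i (x ^ i) : A[X]) * monomial 1 a ^ (n - i)
          = monomial n (c i * a ^ (n - i)) := by
        intro i hi
        rw [monomial_pow, C_mul_monomial, monomial_mul_monomial, hd i hi]
        rw [Finset.mem_Icc] at hi
        rw [show i + 1 * (n - i) = n by omega]
      rw [Finset.sum_congr rfl h1, ← map_sum, monomial_pow, one_mul, ← map_add, heq, map_zero]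
  intro r
  obtain ⟨⟨p, hp⟩, rfl⟩ := h.surjective r
  have hp' := hp
  rw [← adjoin_monomial_eq_reesAlgebra] at hp'
  induction hp' using Algebra.adjoin_induction with
  | mem p hp' =>
    obtain ⟨a, ha, rfl⟩ := hp'
    exact hmon a (by simpa using ha)
  | algebraMap a => exact hC a
  | add p q hp1 hq1 hp2 hq2 =>
    rw [adjoin_monomial_eq_reesAlgebra] at hp1 hq1
    have h1 := (hp2 hp1).add ψ (hq2 hq1)
    rwa [← map_add] at h1
  | mul p q hp1 hq1 hp2 hq2 =>
    rw [adjoin_monomial_eq_reesAlgebra] at hp1 hq1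
    have h1 := (hp2 hp1).mul ψ (hq2 hq1)
    rwa [← map_mul] at h1

/-- If p has order j, then in degree n + j of the product the lowest term of p meets y_n, while the
higher terms meet y_i with i < n, already treated by induction. So each homogeneous component of a
torsion element is killed by (xT)^j. -/
theorem exists_pow_mul_coeff_mem (h : IsReesQuotient k I J x φ) {p : k[X]} (hp : p ≠ 0)
    {y : reesAlgebra I} (hy : φ (reesParam k h.mem p) * φ y = 0) :
    ∃ j, ∀ n, x ^ j * (y : A[X]).coeff n ∈ J * I ^ (n + j) := by
  rw [← map_mul, h.map_eq_zero_iff] at hy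
  set j := p.natTrailingDegree with hj
  refine ⟨j, fun n => ?_⟩
  induction n using Nat.strong_induction_on with
  | _ n ih =>
    have hc : IsUnit (algebraMap k A (p.coeff j)) :=
      (IsUnit.mk0 _ (by simpa [hj] using trailingCoeff_nonzero_iff_nonzero.2 hp)).map _
    have h1 := hy (n + j)
    rw [MulMemClass.coe_mul, coeff_mul, ← Finset.add_sum_erase _ _
      (show (j, n) ∈ Finset.HasAntidiagonal.antidiagonal (n + j) by simp [add_comm])] at h1
    have h2 : ∑ i ∈ (Finset.HasAntidiagonal.antidiagonal (n + j)).erase (j, n),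
        (reesParam k h.mem p : A[X]).coeff i.1 * (y : A[X]).coeff i.2 ∈ J * I ^ (n + j) := by
      refine Ideal.sum_mem _ fun i hi => ?_
      rw [Finset.mem_erase, Finset.HasAntidiagonal.mem_antidiagonal] at hi
      obtain ⟨hne, hsum⟩ := hi
      rw [coeff_reesParam]
      rcases lt_trichotomy i.1 j with hlt | heq | hgt
      · rw [coeff_eq_zero_of_lt_natTrailingDegree hlt, map_zero, zero_mul, zero_mul]
        exact zero_mem _
      · exact absurd (Prod.ext heq (by simp; omega)) hne
      · have h3 := ih i.2 (by omega)
        have h4 := Ideal.mul_mem_mul h3 (Ideal.pow_mem_pow h.mem (i.1 - j))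
        rw [mul_assoc J, ← pow_add, show i.2 + j + (i.1 - j) = n + j by omega] at h4
        have h5 : x ^ i.1 = x ^ j * x ^ (i.1 - j) := by
          rw [← pow_add]
          congr 1
          omega
        rw [h5]
        convert Ideal.mul_mem_left _ (algebraMap k A (p.coeff i.1)) h4 using 1
        ring
    have h3 := (Submodule.add_mem_iff_left _ h2).1 h1
    rw [coeff_reesParam, mul_assoc] at h3
    exact (Ideal.unit_mul_mem_iff_mem _ hc).1 h3

/-- The maximal ideal of `R` generated by `𝔪` and the elements of positive degree. -/
noncomputable def maxIdeal (_ : IsReesQuotient k I J x φ) : Ideal R :=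
  ((maximalIdeal A).comap (reesConstantCoeff I)).map φ

theorem mem_maxIdeal_iff (h : IsReesQuotient k I J x φ) (p : reesAlgebra I) :
    φ p ∈ h.maxIdeal ↔ (p : A[X]).coeff 0 ∈ maximalIdeal A := by
  refine ⟨fun hp => ?_, fun hp => Ideal.mem_map_of_mem φ hp⟩
  obtain ⟨q, hq, hqp⟩ := (Ideal.mem_map_iff_of_surjective φ h.surjective).1 hp
  have h1 : φ (p - q) = 0 := by rw [map_sub, hqp, sub_self]
  have h2 := h.le (by simpa using (h.map_eq_zero_iff _).1 h1 0)
  have h3 := add_mem h2 hq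
  rw [reesConstantCoeff_apply] at h3
  simpa using h3

theorem isMaximal_maxIdeal (h : IsReesQuotient k I J x φ) : h.maxIdeal.IsMaximal := by
  have hsurj : Function.Surjective (reesConstantCoeff I) := fun a =>
    ⟨algebraMap A _ a, by change (C a).coeff 0 = a; simp⟩
  have := Ideal.comap_isMaximal_of_surjective (reesConstantCoeff I) hsurj (K := maximalIdeal A)
  refine (Ideal.map_eq_top_or_isMaximal_of_surjective φ h.surjective this).resolve_left ?_
  intro htop
  have h1 : φ 1 ∈ h.maxIdeal := by
    rw [maxIdeal, htop]
    trivial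
  rw [h.mem_maxIdeal_iff] at h1
  simp at h1

theorem isCohenMacaulayRing (h : IsReesQuotient k I J x φ) [IsNoetherianRing R]
    (htors : ∀ n, ∀ y ∈ I ^ n, x * y ∈ J * I ^ (n + 1) → y ∈ J * I ^ n) :
    IsCohenMacaulayRing R := by
  let _ := (φ.comp (reesParam k h.mem)).toAlgebra
  have : Algebra.IsIntegral k[X] R := ⟨h.isIntegral⟩
  refine isCohenMacaulayRing_of_isIntegral (B := k[X]) (Polynomial.not_isField k)
    fun p y hp hy => ?_
  obtain ⟨y, rfl⟩ := h.surjective y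
  obtain ⟨j, hj⟩ := h.exists_pow_mul_coeff_mem hp hy
  have key : ∀ j n b, b ∈ I ^ n → x ^ j * b ∈ J * I ^ (n + j) → b ∈ J * I ^ n := by
    intro j
    induction j with
    | zero => simp
    | succ j ih =>
      intro n b hb hjb
      refine htors n b hb (ih (n + 1) _ ?_ ?_)
      · rw [pow_succ']
        exact Ideal.mul_mem_mul h.mem hb
      · rw [← mul_assoc, ← pow_succ, show n + 1 + j = n + (j + 1) by omega]
        exact hjb
  exact (h.map_eq_zero_iff y).2 fun n => key j n _ (y.2 n) (hj n)

theorem isBuchsbaumRing (h : IsReesQuotient k I J x φ) [IsNoetherianRing R]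
    (htors : ∀ n, ∀ y ∈ I ^ n, ∀ j, x ^ j * y ∈ J * I ^ (n + j) →
      (∀ a ∈ maximalIdeal A, a * y ∈ J * I ^ n) ∧ ∀ a ∈ I, a * y ∈ J * I ^ (n + 1)) :
    IsBuchsbaumRing R := by
  let _ := (φ.comp (reesParam k h.mem)).toAlgebra
  have : Algebra.IsIntegral k[X] R := ⟨h.isIntegral⟩
  have := h.isMaximal_maxIdeal
  refine isBuchsbaumRing_of_isIntegral (B := k[X]) (Polynomial.not_isField k) h.maxIdeal
    fun p y hp hy g hg => ?_
  obtain ⟨y, rfl⟩ := h.surjective y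
  obtain ⟨g, rfl⟩ := h.surjective g
  rw [h.mem_maxIdeal_iff] at hg
  obtain ⟨j, hj⟩ := h.exists_pow_mul_coeff_mem hp hy
  rw [← map_mul, h.map_eq_zero_iff]
  intro n
  rw [MulMemClass.coe_mul, coeff_mul]
  refine Ideal.sum_mem _ fun i hi => ?_
  obtain ⟨h1, h2⟩ := htors i.2 _ (y.2 i.2) j (hj i.2)
  obtain ⟨a, b⟩ := i
  rw [Finset.HasAntidiagonal.mem_antidiagonal] at hi
  subst hi
  cases a with
  | zero => simpa using h1 _ hg
  | succ a =>
    have h3 := mul_mem_pow_mul_of_forall h2 a (g.2 (a + 1))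
    rwa [mul_left_comm, ← pow_add, show a + (b + 1) = a + 1 + b by omega] at h3

/-- Outside the maximal ideal the coefficient of degree zero is a unit, so the degree-n coefficient
of the product is a unit times x^n. Thus xT is not nilpotent in the localization. -/
theorem mul_pow_ne_zero (h : IsReesQuotient k I J x φ) (n : ℕ) (u : R) (hu : u ∉ h.maxIdeal) :
    u * φ (reesParam k h.mem X) ^ n ≠ 0 := by
  obtain ⟨u, rfl⟩ := h.surjective u
  rw [h.mem_maxIdeal_iff] at hu
  rw [← map_pow, ← map_pow, ← map_mul, Ne, h.map_eq_zero_iff]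
  intro h0
  have h1 := h0 n
  rw [MulMemClass.coe_mul, coeff_mul, Finset.sum_eq_single (0, n)] at h1
  · rw [coeff_reesParam, coeff_X_pow, if_pos rfl, map_one, one_mul] at h1
    exact h.pow_notMem n ((Ideal.unit_mul_mem_iff_mem _ (by simpa using hu)).1 h1)
  · rintro ⟨a, b⟩ hab hne
    rw [coeff_reesParam, coeff_X_pow, if_neg, map_zero, zero_mul, mul_zero]
    rintro rfl
    rw [Finset.HasAntidiagonal.mem_antidiagonal] at hab
    exact hne (Prod.ext (by simp at hab ⊢; omega) rfl)
  · simp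

theorem mul_reesMonomial_ne_zero (h : IsReesQuotient k I J x φ) {n : ℕ} {z : A} (hz : z ∈ I ^ n)
    (hzJ : z ∉ J * I ^ n) (u : R) (hu : u ∉ h.maxIdeal) : u * φ (reesMonomial n z hz) ≠ 0 := by
  obtain ⟨u, rfl⟩ := h.surjective u
  rw [h.mem_maxIdeal_iff] at hu
  rw [← map_mul, Ne, h.map_eq_zero_iff]
  intro h0
  have h1 := h0 n
  rw [MulMemClass.coe_mul, coeff_mul, Finset.sum_eq_single (0, n)] at h1
  · rw [coeff_reesMonomial, if_pos rfl] at h1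
    exact hzJ ((Ideal.unit_mul_mem_iff_mem _ (by simpa using hu)).1 h1)
  · rintro ⟨a, b⟩ hab hne
    rw [coeff_reesMonomial, if_neg, mul_zero]
    rintro rfl
    rw [Finset.HasAntidiagonal.mem_antidiagonal] at hab
    exact hne (Prod.ext (by simp at hab ⊢; omega) rfl)
  · simp

theorem not_isCohenMacaulayRing (h : IsReesQuotient k I J x φ) {n : ℕ} {z : A} (hz : z ∈ I ^ n)
    (hzJ : z ∉ J * I ^ n) (hm : ∀ a ∈ maximalIdeal A, a * z ∈ J * I ^ n)
    (hI : ∀ a ∈ I, a * z ∈ J * I ^ (n + 1)) : ¬ IsCohenMacaulayRing R := by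
  have := h.isMaximal_maxIdeal
  refine not_isCohenMacaulayRing_of_socle h.maxIdeal (f := φ (reesParam k h.mem X))
    (z := φ (reesMonomial n z hz)) ?_ h.mul_pow_ne_zero (h.mul_reesMonomial_ne_zero hz hzJ) ?_
  · rw [h.mem_maxIdeal_iff, coeff_reesParam]
    simp
  · intro g hg
    obtain ⟨g, rfl⟩ := h.surjective g
    rw [h.mem_maxIdeal_iff] at hg
    rw [← map_mul, h.map_eq_zero_iff]
    intro N
    rw [MulMemClass.coe_mul, coeff_mul]
    refine Ideal.sum_mem _ fun i hi => ?_
    obtain ⟨a, b⟩ := i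
    rw [Finset.HasAntidiagonal.mem_antidiagonal] at hi
    subst hi
    rw [coeff_reesMonomial]
    split_ifs with hb
    · subst hb
      cases a with
      | zero => simpa using hm _ hg
      | succ a =>
        have h3 := mul_mem_pow_mul_of_forall hI a (g.2 (a + 1))
        rwa [mul_left_comm, ← pow_add, show a + (n + 1) = a + 1 + n by omega] at h3
    · rw [mul_zero]
      exact zero_mem _

theorem not_isBuchsbaumRing (h : IsReesQuotient k I J x φ) {n j : ℕ} {a z : A} (hz : z ∈ I ^ n)
    (hj : j ≠ 0) (hxz : x ^ j * z ∈ J * I ^ (n + j)) (ha : a ∈ I)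
    (haz : a * z ∉ J * I ^ (n + 1)) : ¬ IsBuchsbaumRing R := by
  let _ := (φ.comp (reesParam k h.mem)).toAlgebra
  have : Algebra.IsIntegral k[X] R := ⟨h.isIntegral⟩
  have := h.isMaximal_maxIdeal
  have ha' : a ∈ I ^ 1 := by simpa using ha
  refine not_isBuchsbaumRing_of_isIntegral (B := k[X]) h.maxIdeal (p := X) irreducible_X
    (z := φ (reesMonomial n z hz)) (g := φ (reesMonomial 1 a ha')) ?_ h.mul_pow_ne_zero hj ?_ ?_ ?_
  · change φ (reesParam k h.mem X) ∈ _
    rw [h.mem_maxIdeal_iff, coeff_reesParam]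
    simp
  · change φ (reesParam k h.mem X) ^ j * _ = 0
    rw [← map_pow, ← map_pow, ← map_mul, h.map_eq_zero_iff]
    intro N
    rw [MulMemClass.coe_mul, coeff_mul]
    refine Ideal.sum_mem _ fun i hi => ?_
    rw [coeff_reesMonomial, coeff_reesParam, coeff_X_pow]
    rw [Finset.HasAntidiagonal.mem_antidiagonal] at hi
    split_ifs with h1 h2
    · rw [← hi, ← h2, h1, add_comm]
      simpa using hxz
    all_goals simp
  · rw [h.mem_maxIdeal_iff, coeff_reesMonomial]
    simp
  · have hmul : reesMonomial 1 a ha' * reesMonomial n z hz = reesMonomial (n + 1) (a * z)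
        (by rw [pow_succ']; exact Ideal.mul_mem_mul ha hz) := by
      apply Subtype.ext
      simp only [reesMonomial, MulMemClass.mk_mul_mk, monomial_mul_monomial, add_comm]
    rw [← map_mul, hmul]
    exact h.mul_reesMonomial_ne_zero _ haz

end IsReesQuotient

end ReesQuotient

/-! ### The fiber cone and the associated graded ring as quotients of the Rees algebra -/

section BlowUp

open Polynomial

theorem mem_map_algebraMap_reesAlgebra_iff {A : Type*} [CommRing A] (I J : Ideal A)
    (p : reesAlgebra I) :
    p ∈ J.map (algebraMap A (reesAlgebra I)) ↔ ∀ n, (p : A[X]).coeff n ∈ J * I ^ n := by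
  constructor
  · intro hp
    rw [Ideal.map] at hp
    refine Submodule.span_induction ?_ ?_ ?_ ?_ hp
    · rintro _ ⟨a, ha, rfl⟩ n
      change (C a).coeff n ∈ _
      rw [coeff_C]
      split_ifs with hn
      · simpa [hn] using ha
      · exact zero_mem _
    · intro n
      simp
    · intro p q _ _ hp hq n
      simpa using add_mem (hp n) (hq n)
    · intro r p _ hp n
      rw [smul_eq_mul, MulMemClass.coe_mul, coeff_mul]
      refine Ideal.sum_mem _ fun i hi => ?_
      rw [Finset.HasAntidiagonal.mem_antidiagonal] at hi
      have := Ideal.mul_mem_mul (r.2 i.1) (hp i.2)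
      rwa [mul_left_comm, ← pow_add, hi] at this
  · intro hp
    have hle : ∀ n, J * I ^ n ≤ I ^ n := fun _ => Ideal.mul_le_right
    have key : ∀ n a (ha : a ∈ J * I ^ n), reesMonomial n a (hle _ ha) ∈
        J.map (algebraMap A (reesAlgebra I)) := by
      intro n a ha
      refine Submodule.mul_induction_on' (C := fun a ha => reesMonomial n a (hle _ ha) ∈
        J.map (algebraMap A (reesAlgebra I))) ?_ ?_ ha
      · intro b hb c hc
        have : reesMonomial n (b * c) (hle _ (Ideal.mul_mem_mul hb hc)) =
            algebraMap A (reesAlgebra I) b * reesMonomial n c hc := by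
          apply Subtype.ext
          change monomial n (b * c) = C b * monomial n c
          rw [C_mul_monomial]
        rw [this]
        exact Ideal.mul_mem_right _ _ (Ideal.mem_map_of_mem _ hb)
      · intro b hb c hc h1 h2
        have : reesMonomial n (b + c) (hle _ (add_mem hb hc)) =
            reesMonomial n b (hle _ hb) + reesMonomial n c (hle _ hc) := by
          apply Subtype.ext
          change monomial n (b + c) = monomial n b + monomial n c
          rw [map_add]
        rw [this]
        exact add_mem h1 h2
    have hsum : p = ∑ n ∈ (p : A[X]).support,
        reesMonomial n ((p : A[X]).coeff n) (hle _ (hp n)) := by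
      apply Subtype.ext
      rw [AddSubmonoidClass.coe_finsetSum]
      exact (p : A[X]).as_sum_support
    rw [hsum]
    exact Ideal.sum_mem _ fun n _ => key n _ (hp n)

/-- Divisibility by T⁻¹ means that the shift of g by T stays in the extended Rees algebra. Negative
degrees impose no condition, as there the ideals are all of A. -/
theorem extendedRees.mem_span_tInv_iff {A : Type*} [CommRing A] (I : Ideal A)
    (g : extendedRees I) :
    g ∈ Ideal.span {extendedRees.tInv I} ↔
      ∀ n : ℕ, (g : LaurentPolynomial A).coeff n ∈ I * I ^ n := by
  have hT : ∀ (m : ℤ) (f : LaurentPolynomial A) (n : ℤ),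
      (LaurentPolynomial.T m * f).coeff n = f.coeff (n - m) := by
    intro m f n
    rw [LaurentPolynomial.T, AddMonoidAlgebra.coeff_single_mul_apply, one_mul, neg_add_eq_sub]
  rw [Ideal.mem_span_singleton]
  constructor
  · rintro ⟨f, rfl⟩ n
    change (LaurentPolynomial.T (-1) * (f : LaurentPolynomial A)).coeff n ∈ _
    rw [hT, ← pow_succ']
    have := f.2 ((n : ℤ) - -1)
    rwa [show ((n : ℤ) - -1).toNat = n + 1 by omega] at this
  · intro h
    refine ⟨⟨LaurentPolynomial.T 1 * (g : LaurentPolynomial A), fun n => ?_⟩, ?_⟩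
    · rw [hT]
      rcases le_or_gt n 0 with hn | hn
      · rw [show n.toNat = 0 by omega]
        simp
      · have := h (n - 1).toNat
        rwa [← pow_succ', show (((n - 1).toNat : ℕ) : ℤ) = n - 1 by omega,
          show (n - 1).toNat + 1 = n.toNat by omega] at this
    · apply Subtype.ext
      change _ = LaurentPolynomial.T (-1) * (LaurentPolynomial.T 1 * (g : LaurentPolynomial A))
      rw [← mul_assoc, ← LaurentPolynomial.T_add]
      simp

theorem coeff_toLaurent_natCast {A : Type*} [CommRing A] (p : A[X]) (n : ℕ) :
    (toLaurent p).coeff (n : ℤ) = p.coeff n := by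
  rw [LaurentPolynomial.coeff_toLaurent]
  exact Finsupp.mapDomain_apply Nat.castEmbedding.injective _ n

theorem coeff_toLaurent_of_neg {A : Type*} [CommRing A] (p : A[X]) {n : ℤ} (hn : n < 0) :
    (toLaurent p).coeff n = 0 := by
  rw [LaurentPolynomial.coeff_toLaurent]
  refine Finsupp.mapDomain_of_notMem_range _ _ ?_
  rintro ⟨m, rfl⟩
  simp at hn
  omega

/-- The inclusion of the Rees algebra into the extended Rees algebra. -/
noncomputable def reesToExtendedRees {A : Type*} [CommRing A] (I : Ideal A) :
    reesAlgebra I →+* extendedRees I :=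
  ((toLaurent : A[X] →+* LaurentPolynomial A).comp (reesAlgebra I).val.toRingHom).codRestrict
    (extendedRees I) fun p n => by
      change (toLaurent (p : A[X])).coeff n ∈ _
      rcases lt_or_ge n 0 with hn | hn
      · rw [coeff_toLaurent_of_neg _ hn]
        exact zero_mem _
      · obtain ⟨n, rfl⟩ := Int.eq_ofNat_of_zero_le hn
        rw [coeff_toLaurent_natCast]
        exact p.2 n

theorem coeff_reesToExtendedRees {A : Type*} [CommRing A] (I : Ideal A) (p : reesAlgebra I)
    (n : ℕ) : (reesToExtendedRees I p : LaurentPolynomial A).coeff (n : ℤ) = (p : A[X]).coeff n :=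
  coeff_toLaurent_natCast _ n

/-- The canonical homomorphism from the Rees algebra to the associated graded ring. -/
noncomputable def reesToAssocGraded {A : Type*} [CommRing A] (I : Ideal A) :
    reesAlgebra I →+* AssocGradedRing I :=
  (Ideal.Quotient.mk _).comp (reesToExtendedRees I)

theorem reesToAssocGraded_eq_zero_iff {A : Type*} [CommRing A] (I : Ideal A)
    (p : reesAlgebra I) :
    reesToAssocGraded I p = 0 ↔ ∀ n, (p : A[X]).coeff n ∈ I * I ^ n := by
  rw [reesToAssocGraded, RingHom.comp_apply, Ideal.Quotient.eq_zero_iff_mem,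
    extendedRees.mem_span_tInv_iff]
  simp only [coeff_reesToExtendedRees]

theorem reesToAssocGraded_surjective {A : Type*} [CommRing A] (I : Ideal A) :
    Function.Surjective (reesToAssocGraded I) := by
  intro g
  obtain ⟨g, rfl⟩ := Ideal.Quotient.mk_surjective g
  -- Dropping the terms of negative degree does not change the class modulo T⁻¹.
  let q : A[X] := ⟨⟨(g : LaurentPolynomial A).coeff.comapDomain Nat.cast
    Nat.cast_injective.injOn⟩⟩
  have hq : ∀ n, q.coeff n = (g : LaurentPolynomial A).coeff (n : ℤ) := fun n => rfl
  refine ⟨⟨q, fun n => ?_⟩, ?_⟩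
  · rw [hq]
    exact g.2 n
  · rw [reesToAssocGraded, RingHom.comp_apply, Ideal.Quotient.eq, extendedRees.mem_span_tInv_iff]
    intro n
    have h : ((reesToExtendedRees I ⟨q, fun n => by rw [hq]; exact g.2 n⟩ - g : extendedRees I) :
        LaurentPolynomial A).coeff (n : ℤ) = 0 := by
      change (toLaurent q).coeff (n : ℤ) - (g : LaurentPolynomial A).coeff (n : ℤ) = 0
      rw [coeff_toLaurent_natCast, hq, sub_self]
    rw [h]
    exact zero_mem _

end BlowUp

/-! ### Monomial ideals of semigroup rings -/

namespace semigroupRing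

variable {k : Type*} [Field k] {H : AddSubmonoid ℕ}

theorem mem_of_coeff_ne_zero (f : semigroupRing k H) {n : ℕ}
    (hn : PowerSeries.coeff n (f : PowerSeries k) ≠ 0) : n ∈ H :=
  by_contra fun h => hn (f.2 n h)

theorem coeff_tPow_mul {e : ℕ} (he : e ∈ H) (f : semigroupRing k H) (n : ℕ) :
    PowerSeries.coeff n ((tPow k e he * f : semigroupRing k H) : PowerSeries k) =
      if e ≤ n then PowerSeries.coeff (n - e) (f : PowerSeries k) else 0 :=
  PowerSeries.coeff_X_pow_mul' _ _ _

theorem coeff_tPow {e : ℕ} (he : e ∈ H) (n : ℕ) :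
    PowerSeries.coeff n (tPow k e he : PowerSeries k) = if n = e then 1 else 0 :=
  PowerSeries.coeff_X_pow _ _

theorem tPow_mul_tPow {a b : ℕ} (ha : a ∈ H) (hb : b ∈ H) :
    tPow k a ha * tPow k b hb = tPow k (a + b) (H.add_mem ha hb) :=
  Subtype.ext (pow_add _ _ _).symm

theorem tPow_pow {a : ℕ} (ha : a ∈ H) (n : ℕ) :
    tPow k a ha ^ n = tPow k (n * a) (by simpa using H.nsmul_mem ha n) :=
  Subtype.ext (by
    change ((PowerSeries.X : PowerSeries k) ^ a) ^ n = PowerSeries.X ^ (n * a)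
    rw [← pow_mul, mul_comm])

theorem exists_of_coeff_mul_ne_zero {f g : semigroupRing k H} {n : ℕ}
    (h : PowerSeries.coeff n ((f * g : semigroupRing k H) : PowerSeries k) ≠ 0) :
    ∃ a b, a + b = n ∧ PowerSeries.coeff a (f : PowerSeries k) ≠ 0 ∧
      PowerSeries.coeff b (g : PowerSeries k) ≠ 0 := by
  rw [MulMemClass.coe_mul, PowerSeries.coeff_mul] at h
  obtain ⟨⟨a, b⟩, hab, hne⟩ := Finset.exists_ne_zero_of_sum_ne_zero h
  rw [Finset.HasAntidiagonal.mem_antidiagonal] at hab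
  exact ⟨a, b, hab, left_ne_zero_of_mul hne, right_ne_zero_of_mul hne⟩

variable (k H) in
/-- The ideal of `k[[H]]` generated by the monomials `t ^ e`, `e ∈ E`. -/
noncomputable def monomialIdeal (E : Set ℕ) : Ideal (semigroupRing k H) :=
  Ideal.span {f | ∃ (e : ℕ) (he : e ∈ H), e ∈ E ∧ f = tPow k e he}

theorem tPow_mem_monomialIdeal {E : Set ℕ} {e : ℕ} (he : e ∈ H) (heE : e ∈ E) :
    tPow k e he ∈ monomialIdeal k H E :=
  Ideal.subset_span ⟨e, he, heE, rfl⟩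

-- One generator per residue class modulo d is enough: the least exponent of H ∩ E in that class.
open Classical in
theorem exists_finset_generators {d : ℕ} (hd : 0 < d) (hdH : d ∈ H) (E : Set ℕ) :
    ∃ G : Finset (semigroupRing k H),
      (∀ g ∈ G, ∃ (e : ℕ) (he : e ∈ H), e ∈ E ∧ g = tPow k e he) ∧
      ∀ f : semigroupRing k H, (∀ n, PowerSeries.coeff n (f : PowerSeries k) ≠ 0 → n ∈ E) →
        f ∈ Ideal.span (G : Set (semigroupRing k H)) := by
  let g : ℕ → ℕ := fun r => sInf {e | e ∈ H ∧ e ∈ E ∧ e % d = r}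
  let T := (Finset.range d).filter fun r => ∃ e, e ∈ H ∧ e ∈ E ∧ e % d = r
  have hT : ∀ r ∈ T, g r ∈ H ∧ g r ∈ E ∧ g r % d = r := fun r hr =>
    Nat.sInf_mem (s := {e | e ∈ H ∧ e ∈ E ∧ e % d = r}) (Finset.mem_filter.1 hr).2
  let q : ℕ → semigroupRing k H := fun r => if h : g r ∈ H then tPow k (g r) h else 0
  have hq : ∀ r (hr : r ∈ T), q r = tPow k (g r) (hT r hr).1 := fun r hr => dif_pos (hT r hr).1
  refine ⟨T.image q, ?_, fun f hf => ?_⟩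
  · intro p hp
    obtain ⟨r, hr, rfl⟩ := Finset.mem_image.1 hp
    exact ⟨g r, (hT r hr).1, (hT r hr).2.1, hq r hr⟩
  -- The part of f in the class of r is t^(g r) times a power series in t^d, which lies in k[[H]]
  -- because d ∈ H.
  · let c : ℕ → semigroupRing k H := fun r =>
      ⟨PowerSeries.mk fun m => if d ∣ m then PowerSeries.coeff (m + g r) (f : PowerSeries k) else 0,
        fun m hm => by
          rw [PowerSeries.coeff_mk, if_neg]
          rintro ⟨l, rfl⟩
          exact hm (by simpa [mul_comm] using H.nsmul_mem hdH l)⟩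
    have hc : ∀ r m, PowerSeries.coeff m (c r : PowerSeries k) =
        if d ∣ m then PowerSeries.coeff (m + g r) (f : PowerSeries k) else 0 := fun r m => by
      simp only [c, PowerSeries.coeff_mk]
    have hsum : f = ∑ r ∈ T, q r * c r := by
      apply Subtype.ext
      ext n
      rw [AddSubmonoidClass.coe_finsetSum, map_sum]
      have hterm : ∀ r ∈ T, PowerSeries.coeff n ((q r * c r : semigroupRing k H) : PowerSeries k) =
          if r = n % d ∧ g r ≤ n then PowerSeries.coeff n (f : PowerSeries k) else 0 := by
        intro r hr
        rw [hq r hr, coeff_tPow_mul, hc]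
        by_cases hle : g r ≤ n
        · have hiff : d ∣ n - g r ↔ r = n % d := by
            rw [← Nat.modEq_iff_dvd' hle, Nat.ModEq, (hT r hr).2.2]
          simp only [hle, if_true, hiff, and_true, Nat.sub_add_cancel hle]
        · simp [hle]
      rw [Finset.sum_congr rfl hterm]
      by_cases hn : PowerSeries.coeff n (f : PowerSeries k) = 0
      · simp [hn]
      · have hmem : n ∈ H ∧ n ∈ E ∧ n % d = n % d := ⟨mem_of_coeff_ne_zero f hn, hf n hn, rfl⟩
        have hle : g (n % d) ≤ n := Nat.sInf_le hmem
        have hnT : n % d ∈ T :=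
          Finset.mem_filter.2 ⟨Finset.mem_range.2 (Nat.mod_lt _ hd), n, hmem⟩
        rw [Finset.sum_eq_single_of_mem _ hnT, if_pos ⟨rfl, hle⟩]
        intro r _ hr
        rw [if_neg]
        exact fun h => hr h.1
    rw [hsum]
    refine Ideal.sum_mem _ fun r hr => Ideal.mul_mem_right _ _ (Ideal.subset_span ?_)
    exact Finset.mem_coe.2 (Finset.mem_image_of_mem _ hr)

theorem mem_monomialIdeal_iff {d : ℕ} (hd : 0 < d) (hdH : d ∈ H) {E : Set ℕ}
    (hE : ∀ e ∈ H, e ∈ E → ∀ h ∈ H, e + h ∈ E) (f : semigroupRing k H) :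
    f ∈ monomialIdeal k H E ↔ ∀ n, PowerSeries.coeff n (f : PowerSeries k) ≠ 0 → n ∈ E := by
  constructor
  · intro hf
    refine Submodule.span_induction ?_ ?_ ?_ ?_ hf
    · rintro _ ⟨e, he, heE, rfl⟩ n hn
      rw [coeff_tPow] at hn
      obtain rfl : n = e := by
        by_contra h
        exact hn (if_neg h)
      exact heE
    · intro n hn
      simp at hn
    · intro f g _ _ hf hg n hn
      rw [AddMemClass.coe_add, map_add] at hn
      by_cases h : PowerSeries.coeff n (f : PowerSeries k) = 0
      · exact hg n (by simpa [h] using hn)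
      · exact hf n h
    · intro r f _ hf n hn
      rw [smul_eq_mul] at hn
      obtain ⟨a, b, rfl, ha, hb⟩ := exists_of_coeff_mul_ne_zero hn
      rw [add_comm]
      exact hE b (mem_of_coeff_ne_zero f hb) (hf b hb) a (mem_of_coeff_ne_zero r ha)
  · intro hf
    obtain ⟨G, hG, hG'⟩ := exists_finset_generators (k := k) hd hdH E
    exact Ideal.span_mono (fun g hg => hG g hg) (hG' f hf)

theorem fg_monomialIdeal {d : ℕ} (hd : 0 < d) (hdH : d ∈ H) {E : Set ℕ}
    (hE : ∀ e ∈ H, e ∈ E → ∀ h ∈ H, e + h ∈ E) : (monomialIdeal k H E).FG := by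
  obtain ⟨G, hG, hG'⟩ := exists_finset_generators (k := k) hd hdH E
  refine ⟨G, le_antisymm (Ideal.span_mono fun g hg => hG g hg) fun f hf => ?_⟩
  exact hG' f ((mem_monomialIdeal_iff hd hdH hE f).1 hf)

theorem monomialIdeal_mul_monomialIdeal {D E F : Set ℕ}
    (h1 : ∀ a ∈ H, a ∈ D → ∀ b ∈ H, b ∈ E → a + b ∈ F)
    (h2 : ∀ n ∈ H, n ∈ F → ∃ a ∈ H, a ∈ D ∧ ∃ b ∈ H, b ∈ E ∧ a + b = n) :
    monomialIdeal k H D * monomialIdeal k H E = monomialIdeal k H F := by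
  rw [monomialIdeal, monomialIdeal, Ideal.span_mul_span']
  apply le_antisymm
  · rw [Ideal.span_le]
    rintro _ ⟨_, ⟨a, ha, haD, rfl⟩, _, ⟨b, hb, hbE, rfl⟩, rfl⟩
    change tPow k a ha * tPow k b hb ∈ _
    rw [tPow_mul_tPow]
    exact tPow_mem_monomialIdeal _ (h1 a ha haD b hb hbE)
  · rw [monomialIdeal, Ideal.span_le]
    rintro _ ⟨n, hn, hnF, rfl⟩
    obtain ⟨a, ha, haD, b, hb, hbE, rfl⟩ := h2 n hn hnF
    rw [← tPow_mul_tPow ha hb]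
    exact Ideal.subset_span ⟨_, ⟨a, ha, haD, rfl⟩, _, ⟨b, hb, hbE, rfl⟩, rfl⟩

theorem span_tPow {s : ℕ} (hs : s ∈ H) :
    Ideal.span {tPow k s hs} = monomialIdeal k H {s} := by
  rw [monomialIdeal]
  congr 1
  ext f
  constructor
  · rintro rfl
    exact ⟨s, hs, rfl, rfl⟩
  · rintro ⟨e, he, rfl, rfl⟩
    rfl

theorem mem_span_tPow_iff {s : ℕ} (hs : s ∈ H) (f : semigroupRing k H) :
    f ∈ Ideal.span {tPow k s hs} ↔
      ∀ n, PowerSeries.coeff n (f : PowerSeries k) ≠ 0 → ∃ h ∈ H, n = s + h := by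
  rw [Ideal.mem_span_singleton]
  constructor
  · rintro ⟨g, rfl⟩ n hn
    rw [coeff_tPow_mul] at hn
    split_ifs at hn with h
    · exact ⟨n - s, mem_of_coeff_ne_zero g hn, by omega⟩
    · exact absurd rfl hn
  · intro hf
    refine ⟨⟨PowerSeries.mk fun n => PowerSeries.coeff (n + s) (f : PowerSeries k), fun n hn => ?_⟩,
      ?_⟩
    · rw [PowerSeries.coeff_mk]
      by_contra h
      obtain ⟨m, hm, heq⟩ := hf _ h
      exact hn (by rwa [show n = m by omega])
    · apply Subtype.ext
      ext n
      rw [coeff_tPow_mul, PowerSeries.coeff_mk]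
      split_ifs with h
      · rw [Nat.sub_add_cancel h]
      · by_contra hne
        obtain ⟨m, -, heq⟩ := hf n hne
        omega

theorem mem_maximalIdeal_iff (f : semigroupRing k H) :
    f ∈ maximalIdeal (semigroupRing k H) ↔ PowerSeries.coeff 0 (f : PowerSeries k) = 0 := by
  rw [mem_maximalIdeal, mem_nonunits_iff]
  constructor
  · intro h
    by_contra h0
    exact h (isUnit_of_constantCoeff_ne_zero f (by simpa using h0))
  · intro h0 h
    have h1 : IsUnit (PowerSeries.constantCoeff (f : PowerSeries k)) :=
      (h.map (semigroupRing k H).val).map PowerSeries.constantCoeff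
    rw [← PowerSeries.coeff_zero_eq_constantCoeff_apply, h0] at h1
    exact not_isUnit_zero h1

theorem maximalIdeal_eq {d : ℕ} (hd : 0 < d) (hdH : d ∈ H) :
    maximalIdeal (semigroupRing k H) = monomialIdeal k H {n | n ≠ 0} := by
  ext f
  rw [mem_maximalIdeal_iff, mem_monomialIdeal_iff hd hdH]
  · constructor
    · rintro h n hn rfl
      exact hn h
    · intro h
      by_contra h0
      exact h 0 h0 rfl
  · intro e _ he h _
    simp only [Set.mem_ofPred_eq] at he ⊢
    omega

theorem le_of_coeff_pow_ne_zero {f : semigroupRing k H}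
    (hf : f ∈ maximalIdeal (semigroupRing k H)) (m n : ℕ)
    (hn : PowerSeries.coeff n ((f ^ m : semigroupRing k H) : PowerSeries k) ≠ 0) : m ≤ n := by
  induction m generalizing n with
  | zero => exact Nat.zero_le n
  | succ m ih =>
    rw [pow_succ] at hn
    obtain ⟨a, b, rfl, ha, hb⟩ := exists_of_coeff_mul_ne_zero hn
    have h1 := ih a ha
    have h2 : b ≠ 0 := by
      rintro rfl
      exact hb ((mem_maximalIdeal_iff f).1 hf)
    omega

/-- A power series divisible by `X ^ c` as an element of `k[[H]]`, where `c` is at least the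
conductor of `H`. -/
noncomputable def xPowMul {c : ℕ} (hc : ∀ n, c ≤ n → n ∈ H) (w : PowerSeries k) :
    semigroupRing k H :=
  ⟨PowerSeries.X ^ c * w, fun n hn => by
    rw [PowerSeries.coeff_X_pow_mul', if_neg]
    exact fun h => hn (hc n h)⟩

/-- Write f = t^a u with u a unit of k[[t]]. For g ∈ 𝔪 the power g^(a+c) is t^(a+c) w, and the
quotient t^c u⁻¹ w by f lies in k[[H]] since c is past the conductor. -/
theorem maximalIdeal_le_radical_span {c : ℕ} (hc : ∀ n, c ≤ n → n ∈ H) {f : semigroupRing k H}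
    (hf : f ≠ 0) : maximalIdeal (semigroupRing k H) ≤ (Ideal.span {f}).radical := by
  have hf0 : (f : PowerSeries k) ≠ 0 := fun h => hf (Subtype.ext h)
  obtain ⟨v, hv⟩ := (PowerSeries.isUnit_divided_by_X_pow_order hf0).exists_right_inv
  have hfeq := PowerSeries.X_pow_order_mul_divXPowOrder (f := (f : PowerSeries k))
  set u := PowerSeries.divXPowOrder (f : PowerSeries k)
  set a := (f : PowerSeries k).order.toNat
  intro g hg
  refine ⟨a + c, Ideal.mem_span_singleton.2 ?_⟩
  obtain ⟨w, hw⟩ : (PowerSeries.X : PowerSeries k) ^ (a + c) ∣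
      ((g ^ (a + c) : semigroupRing k H) : PowerSeries k) := by
    refine PowerSeries.X_pow_dvd_iff.2 fun m hm => ?_
    by_contra hne
    exact absurd (le_of_coeff_pow_ne_zero hg _ m hne) (not_le.2 hm)
  refine ⟨xPowMul hc (v * w), Subtype.ext ?_⟩
  rw [hw, MulMemClass.coe_mul]
  change _ = (f : PowerSeries k) * (PowerSeries.X ^ c * (v * w))
  rw [← hfeq, pow_add]
  linear_combination (-PowerSeries.X ^ a * PowerSeries.X ^ c * w) * hv

/-- By Cohen's theorem only nonzero primes need finite generation, and the only one is 𝔪. -/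
theorem isNoetherianRing {d c : ℕ} (hd : 0 < d) (hdH : d ∈ H) (hc : ∀ n, c ≤ n → n ∈ H) :
    IsNoetherianRing (semigroupRing k H) := by
  refine IsNoetherianRing.of_prime_ne_bot fun P hP hne => ?_
  obtain ⟨f, hfP, hf⟩ := Submodule.exists_mem_ne_zero_of_ne_bot hne
  have h1 : maximalIdeal (semigroupRing k H) ≤ P := (maximalIdeal_le_radical_span hc hf).trans
    ((Ideal.IsRadical.radical_le_iff hP.isRadical).2
      ((Ideal.span_singleton_le_iff_mem P).2 hfP))
  rw [← (maximalIdeal.isMaximal (semigroupRing k H)).eq_of_le hP.ne_top h1, maximalIdeal_eq hd hdH]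
  refine fg_monomialIdeal hd hdH fun e _ he h _ => ?_
  simp only [Set.mem_ofPred_eq] at he ⊢
  omega

theorem tPow_ne_zero {s : ℕ} (hs : s ∈ H) : tPow k s hs ≠ 0 := by
  intro h
  have h1 := congrArg (fun f : semigroupRing k H => PowerSeries.coeff s (f : PowerSeries k)) h
  simp only [coeff_tPow] at h1
  simp at h1

theorem tPow_mem_maximalIdeal {s : ℕ} (hs : s ∈ H) (h0 : s ≠ 0) :
    tPow k s hs ∈ maximalIdeal (semigroupRing k H) := by
  rw [mem_maximalIdeal_iff, coeff_tPow, if_neg h0.symm]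

theorem ringKrullDim_eq_one {d c : ℕ} (hd : 0 < d) (hdH : d ∈ H) (hc : ∀ n, c ≤ n → n ∈ H) :
    ringKrullDim (semigroupRing k H) = 1 := by
  rw [ringKrullDim_eq_one_iff_of_isLocalRing_isDomain]
  refine ⟨fun h => ?_, fun f hf => maximalIdeal_le_radical_span hc hf⟩
  have h1 := tPow_mem_maximalIdeal (k := k) hdH hd.ne'
  rw [IsLocalRing.isField_iff_maximalIdeal_eq.1 h] at h1
  exact tPow_ne_zero hdH h1

theorem isCohenMacaulayLocal {d c : ℕ} (hd : 0 < d) (hdH : d ∈ H) (hc : ∀ n, c ≤ n → n ∈ H) :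
    IsCohenMacaulayLocal (semigroupRing k H) := by
  have := isNoetherianRing (k := k) hd hdH hc
  have : Ring.KrullDimLE 1 (semigroupRing k H) :=
    Ring.krullDimLE_iff.2 (ringKrullDim_eq_one hd hdH hc).le
  refine isCohenMacaulayLocal_of_krullDimLE_one (tPow_mem_maximalIdeal hdH hd.ne') ?_
  exact fun y z hyz => mul_left_cancel₀ (tPow_ne_zero hdH) hyz

/-- The tail of u from degree c on already lies in k[[H]]; the rest is a polynomial in X, which is
integral because X^d ∈ k[[H]]. -/
theorem isIntegral_powerSeries {d c : ℕ} (hd : 0 < d) (hdH : d ∈ H) (hc : ∀ n, c ≤ n → n ∈ H)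
    (u : PowerSeries k) : IsIntegral (semigroupRing k H) u := by
  have hX : IsIntegral (semigroupRing k H) (PowerSeries.X : PowerSeries k) :=
    IsIntegral.of_pow hd (isIntegral_algebraMap (x := tPow k d hdH))
  obtain ⟨w, hw⟩ : (PowerSeries.X : PowerSeries k) ^ c ∣ u - (PowerSeries.trunc c u : _) := by
    refine PowerSeries.X_pow_dvd_iff.2 fun m hm => ?_
    rw [map_sub, Polynomial.coeff_coe, PowerSeries.coeff_trunc, if_pos hm, sub_self]
  rw [← sub_add_cancel u (PowerSeries.trunc c u : PowerSeries k), hw]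
  refine (isIntegral_algebraMap (x := xPowMul (H := H) hc w)).add ?_
  rw [(PowerSeries.trunc c u).as_sum_range_C_mul_X_pow, ← Polynomial.coeToPowerSeries.ringHom_apply,
    map_sum]
  refine IsIntegral.sum _ fun i _ => ?_
  rw [map_mul, map_pow, Polynomial.coeToPowerSeries.ringHom_apply,
    Polynomial.coeToPowerSeries.ringHom_apply, Polynomial.coe_C, Polynomial.coe_X]
  exact (isIntegral_algebraMap (x := algebraMap k (semigroupRing k H) _)).mul (hX.pow i)

/-- Write f = t^s u. A monic equation of degree n for u over k[[H]], multiplied by t^(sn), is an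
equation of integral dependence of f on (t^s). -/
theorem isIntegralOverIdeal_of_le {d c : ℕ} (hd : 0 < d) (hdH : d ∈ H)
    (hc : ∀ n, c ≤ n → n ∈ H) {s : ℕ} (hs : s ∈ H) {f : semigroupRing k H}
    (hf : ∀ n, PowerSeries.coeff n (f : PowerSeries k) ≠ 0 → s ≤ n) :
    IsIntegralOverIdeal (Ideal.span {tPow k s hs}) f := by
  obtain ⟨u, hu⟩ : (PowerSeries.X : PowerSeries k) ^ s ∣ (f : PowerSeries k) := by
    refine PowerSeries.X_pow_dvd_iff.2 fun m hm => ?_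
    by_contra hne
    exact absurd (hf m hne) (not_le.2 hm)
  obtain ⟨P, hP, hPu⟩ := isIntegral_powerSeries (k := k) hd hdH hc u
  set n := P.natDegree with hn
  rw [Polynomial.eval₂_eq_sum_range, Finset.sum_range_succ, hP.coeff_natDegree, map_one,
    one_mul] at hPu
  refine ⟨n, fun i => P.coeff (n - i) * tPow k s hs ^ i, ?_, ?_, ?_⟩
  · rw [Nat.pos_iff_ne_zero]
    intro h0
    rw [← hn, h0] at hPu
    simp at hPu
  · intro i _
    exact Ideal.mul_mem_left _ _ (Ideal.pow_mem_pow (Ideal.mem_span_singleton_self _) i)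
  · apply Subtype.ext
    simp only [AddMemClass.coe_add, AddSubmonoidClass.coe_finsetSum, MulMemClass.coe_mul,
      SubmonoidClass.coe_pow, ZeroMemClass.coe_zero]
    have h1 : ∑ i ∈ Finset.Icc 1 n, (P.coeff (n - i) : PowerSeries k) *
        (tPow k s hs : PowerSeries k) ^ i * (f : PowerSeries k) ^ (n - i) =
        ∑ i ∈ Finset.range n, (PowerSeries.X ^ s) ^ n *
          (algebraMap (semigroupRing k H) (PowerSeries k) (P.coeff i) * u ^ i) := by
      refine Finset.sum_bij' (fun i _ => n - i) (fun i _ => n - i) ?_ ?_ ?_ ?_ ?_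
      · intro i hi
        rw [Finset.mem_Icc] at hi
        rw [Finset.mem_range]
        omega
      · intro i hi
        rw [Finset.mem_range] at hi
        rw [Finset.mem_Icc]
        omega
      · intro i hi
        rw [Finset.mem_Icc] at hi
        omega
      · intro i hi
        rw [Finset.mem_range] at hi
        omega
      · intro i hi
        rw [Finset.mem_Icc] at hi
        have h2 : ((PowerSeries.X : PowerSeries k) ^ s) ^ n =
            (PowerSeries.X ^ s) ^ i * (PowerSeries.X ^ s) ^ (n - i) := by
          rw [← pow_add]
          congr 1
          omega
        rw [h2, hu]
        change (P.coeff (n - i) : PowerSeries k) * (PowerSeries.X ^ s) ^ i * _ =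
          _ * ((P.coeff (n - i) : PowerSeries k) * _)
        ring
    rw [h1, ← Finset.mul_sum, hu, mul_pow, ← mul_add, add_comm, hPu, mul_zero]

/-! ### Blow-up algebras of monomial ideals -/

/-- The powers `I ^ n` and the products `J * I ^ n` are the monomial ideals with exponent sets `E n`
and `D n`. -/
structure IsMonomialFiltration (I J : Ideal (semigroupRing k H)) (E D : ℕ → Set ℕ) : Prop where
  mem_pow_iff : ∀ n f, f ∈ I ^ n ↔ ∀ e, PowerSeries.coeff e (f : PowerSeries k) ≠ 0 → e ∈ E n
  mem_mul_pow_iff : ∀ n f, f ∈ J * I ^ n ↔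
    ∀ e, PowerSeries.coeff e (f : PowerSeries k) ≠ 0 → e ∈ D n

theorem pow_eq_monomialIdeal {I : Ideal (semigroupRing k H)} {E : ℕ → Set ℕ}
    (hI : I = monomialIdeal k H (E 1)) (h0 : ∀ e, e ∈ E 0)
    (h1 : ∀ n, ∀ a ∈ H, a ∈ E n → ∀ b ∈ H, b ∈ E 1 → a + b ∈ E (n + 1))
    (h2 : ∀ n, ∀ e ∈ H, e ∈ E (n + 1) → ∃ a ∈ H, a ∈ E n ∧ ∃ b ∈ H, b ∈ E 1 ∧ a + b = e) (n : ℕ) :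
    I ^ n = monomialIdeal k H (E n) := by
  induction n with
  | zero =>
    rw [pow_zero, Ideal.one_eq_top, eq_comm, Ideal.eq_top_iff_one]
    exact tPow_mem_monomialIdeal H.zero_mem (h0 0)
  | succ n ih =>
    rw [pow_succ, ih]
    conv_lhs => rw [hI]
    exact monomialIdeal_mul_monomialIdeal (h1 n) (h2 n)

theorem coeff_tPow_self_iff {e : ℕ} (he : e ∈ H) (S : Set ℕ) :
    (∀ n, PowerSeries.coeff n (tPow k e he : PowerSeries k) ≠ 0 → n ∈ S) ↔ e ∈ S := by
  constructor
  · intro h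
    exact h e (by rw [coeff_tPow, if_pos rfl]; exact one_ne_zero)
  · intro h n hn
    rw [coeff_tPow] at hn
    by_cases hne : n = e
    · exact hne ▸ h
    · exact absurd (if_neg hne) hn

namespace IsMonomialFiltration

variable {I J : Ideal (semigroupRing k H)} {E D : ℕ → Set ℕ}

theorem tPow_mem_pow_iff (h : IsMonomialFiltration I J E D) {e n : ℕ} (he : e ∈ H) :
    tPow k e he ∈ I ^ n ↔ e ∈ E n := by
  rw [h.mem_pow_iff, coeff_tPow_self_iff]

theorem tPow_mem_mul_pow_iff (h : IsMonomialFiltration I J E D) {e n : ℕ} (he : e ∈ H) :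
    tPow k e he ∈ J * I ^ n ↔ e ∈ D n := by
  rw [h.mem_mul_pow_iff, coeff_tPow_self_iff]

theorem mul_mem_mul_pow (h : IsMonomialFiltration I J E D) {f g : semigroupRing k H} {n : ℕ}
    (hfg : ∀ a ∈ H, PowerSeries.coeff a (f : PowerSeries k) ≠ 0 → ∀ b ∈ H,
      PowerSeries.coeff b (g : PowerSeries k) ≠ 0 → a + b ∈ D n) : f * g ∈ J * I ^ n := by
  rw [h.mem_mul_pow_iff]
  intro e he
  obtain ⟨a, b, rfl, ha, hb⟩ := exists_of_coeff_mul_ne_zero he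
  exact hfg a (mem_of_coeff_ne_zero f ha) ha b (mem_of_coeff_ne_zero g hb) hb

theorem coeff_ne_zero_of_mem {f : semigroupRing k H}
    (hf : f ∈ maximalIdeal (semigroupRing k H)) {a : ℕ}
    (ha : PowerSeries.coeff a (f : PowerSeries k) ≠ 0) : a ≠ 0 := by
  rintro rfl
  exact ha ((mem_maximalIdeal_iff f).1 hf)

variable {R : Type*} [CommRing R] {φ : reesAlgebra I →+* R} {s : ℕ} {hs : s ∈ H}

theorem isReesQuotient (h : IsMonomialFiltration I J E D) {d c : ℕ} (hd : 0 < d) (hdH : d ∈ H)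
    (hc : ∀ n, c ≤ n → n ∈ H) (hφ : Function.Surjective φ)
    (hker : ∀ p, φ p = 0 ↔ ∀ n, (p : Polynomial (semigroupRing k H)).coeff n ∈ J * I ^ n)
    {c' : ℕ} (hJ : ∀ e, c' ≤ e → e ∈ D 0) (hsE : s ∈ E 1) (hE : ∀ e ∈ H, e ∈ E 1 → s ≤ e)
    (hD : ∀ n, n * s ∉ D n) : IsReesQuotient k I J (tPow k s hs) φ where
  mem := by
    rw [← pow_one I, h.tPow_mem_pow_iff]
    exact hsE
  surjective := hφ
  map_eq_zero_iff := hker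
  le := by
    intro f hf
    rw [mem_maximalIdeal_iff]
    by_contra hne
    refine hD 0 ?_
    rw [zero_mul]
    exact (h.mem_mul_pow_iff 0 f).1 (by simpa using hf) 0 hne
  exists_pow_mem := by
    intro f hf
    refine ⟨c', ?_⟩
    have : f ^ c' ∈ J * I ^ 0 := by
      rw [h.mem_mul_pow_iff]
      exact fun e he => hJ e (le_of_coeff_pow_ne_zero hf c' e he)
    simpa using this
  exists_sub_mem := by
    intro f
    refine ⟨PowerSeries.coeff 0 (f : PowerSeries k), ?_⟩
    rw [mem_maximalIdeal_iff]
    change PowerSeries.coeff 0 ((f : PowerSeries k) - PowerSeries.C _) = 0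
    simp
  isIntegralOverIdeal := by
    intro f hf
    refine isIntegralOverIdeal_of_le hd hdH hc hs fun n hn => ?_
    exact hE n (mem_of_coeff_ne_zero f hn) ((h.mem_pow_iff 1 f).1 (by simpa using hf) n hn)
  pow_notMem := by
    intro n
    rw [tPow_pow, h.tPow_mem_mul_pow_iff]
    exact hD n

theorem isCohenMacaulayRing (h : IsMonomialFiltration I J E D)
    (hφ : IsReesQuotient k I J (tPow k s hs) φ) [IsNoetherianRing R]
    (htors : ∀ n, ∀ e ∈ H, e ∈ E n → e + s ∈ D (n + 1) → e ∈ D n) : IsCohenMacaulayRing R := by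
  refine hφ.isCohenMacaulayRing fun n y hy hxy => ?_
  rw [h.mem_mul_pow_iff] at hxy ⊢
  rw [h.mem_pow_iff] at hy
  intro e he
  refine htors n e (mem_of_coeff_ne_zero y he) (hy e he) (hxy _ ?_)
  rw [coeff_tPow_mul, if_pos (by omega), Nat.add_sub_cancel]
  exact he

theorem isBuchsbaumRing (h : IsMonomialFiltration I J E D)
    (hφ : IsReesQuotient k I J (tPow k s hs) φ) [IsNoetherianRing R]
    (htors : ∀ n, ∀ e ∈ H, ∀ j, e ∈ E n → e + j * s ∈ D (n + j) →
      (∀ a ∈ H, a ≠ 0 → a + e ∈ D n) ∧ ∀ a ∈ H, a ∈ E 1 → a + e ∈ D (n + 1)) :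
    IsBuchsbaumRing R := by
  refine hφ.isBuchsbaumRing fun n y hy j hxy => ?_
  rw [tPow_pow, h.mem_mul_pow_iff] at hxy
  rw [h.mem_pow_iff] at hy
  have key : ∀ e ∈ H, PowerSeries.coeff e (y : PowerSeries k) ≠ 0 →
      (∀ a ∈ H, a ≠ 0 → a + e ∈ D n) ∧ ∀ a ∈ H, a ∈ E 1 → a + e ∈ D (n + 1) := by
    intro e heH he
    refine htors n e heH j (hy e he) (hxy _ ?_)
    rw [coeff_tPow_mul, if_pos (by omega), Nat.add_sub_cancel]
    exact he
  refine ⟨fun a ha => h.mul_mem_mul_pow ?_, fun a ha => h.mul_mem_mul_pow ?_⟩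
  · intro b hbH hb e heH he
    exact (key e heH he).1 b hbH (coeff_ne_zero_of_mem ha hb)
  · intro b hbH hb e heH he
    exact (key e heH he).2 b hbH ((h.mem_pow_iff 1 a).1 (by simpa using ha) b hb)

theorem not_isCohenMacaulayRing (h : IsMonomialFiltration I J E D)
    (hφ : IsReesQuotient k I J (tPow k s hs) φ) (n e : ℕ) (he : e ∈ H) (heE : e ∈ E n)
    (heD : e ∉ D n) (h1 : ∀ a ∈ H, a ≠ 0 → a + e ∈ D n)
    (h2 : ∀ a ∈ H, a ∈ E 1 → a + e ∈ D (n + 1)) : ¬ IsCohenMacaulayRing R := by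
  refine hφ.not_isCohenMacaulayRing (n := n) (z := tPow k e he) ((h.tPow_mem_pow_iff he).2 heE)
    (by rwa [h.tPow_mem_mul_pow_iff]) ?_ ?_
  · intro a ha
    refine h.mul_mem_mul_pow fun b hbH hb => ?_
    exact fun c _ => (coeff_tPow_self_iff he {c | b + c ∈ D n}).2
      (h1 b hbH (coeff_ne_zero_of_mem ha hb)) c
  · intro a ha
    refine h.mul_mem_mul_pow fun b hbH hb => ?_
    exact fun c _ => (coeff_tPow_self_iff he {c | b + c ∈ D (n + 1)}).2
      (h2 b hbH ((h.mem_pow_iff 1 a).1 (by simpa using ha) b hb)) c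

theorem not_isBuchsbaumRing (h : IsMonomialFiltration I J E D)
    (hφ : IsReesQuotient k I J (tPow k s hs) φ) (n e a j : ℕ) (he : e ∈ H) (heE : e ∈ E n)
    (ha : a ∈ H) (haE : a ∈ E 1) (hj : j ≠ 0) (hjD : j * s + e ∈ D (n + j))
    (hD : a + e ∉ D (n + 1)) : ¬ IsBuchsbaumRing R := by
  refine hφ.not_isBuchsbaumRing (n := n) (j := j) (a := tPow k a ha) (z := tPow k e he)
    ((h.tPow_mem_pow_iff he).2 heE) hj ?_ ?_ ?_
  · rwa [tPow_pow, tPow_mul_tPow, h.tPow_mem_mul_pow_iff]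
  · rw [← pow_one I]
    exact (h.tPow_mem_pow_iff ha).2 haE
  · rwa [tPow_mul_tPow, h.tPow_mem_mul_pow_iff]

end IsMonomialFiltration

end semigroupRing

/-! ### The semigroup `⟨4, 7, 9⟩` -/

theorem mem_semigroup479_iff (n : ℕ) :
    n ∈ semigroup479 ↔ n = 0 ∨ n = 4 ∨ n = 7 ∨ n = 8 ∨ n = 9 ∨ 11 ≤ n := by
  constructor
  · intro hn
    induction hn using AddSubmonoid.closure_induction with
    | mem x hx =>
      simp only [Set.mem_insert_iff, Set.mem_singleton_iff] at hx
      omega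
    | zero => simp
    | add x y _ _ hx hy => omega
  · have h4 : 4 ∈ semigroup479 := AddSubmonoid.subset_closure (by simp)
    have h7 : 7 ∈ semigroup479 := AddSubmonoid.subset_closure (by simp)
    have h9 : 9 ∈ semigroup479 := AddSubmonoid.subset_closure (by simp)
    have h11 : ∀ n, n + 11 ∈ semigroup479 := by
      intro n
      induction n using Nat.strong_induction_on with
      | _ n ih =>
        match n with
        | 0 => exact (add_mem h4 h7 : 4 + 7 ∈ semigroup479)
        | 1 => exact (add_mem (add_mem h4 h4) h4 : 4 + 4 + 4 ∈ semigroup479)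
        | 2 => exact (add_mem h4 h9 : 4 + 9 ∈ semigroup479)
        | 3 => exact (add_mem h7 h7 : 7 + 7 ∈ semigroup479)
        | n + 4 =>
          have := add_mem (ih n (by omega)) h4
          rwa [show n + 11 + 4 = n + 4 + 11 by omega] at this
    rintro (rfl | rfl | rfl | rfl | rfl | h)
    · exact zero_mem _
    · exact h4
    · exact h7
    · exact add_mem h4 h4
    · exact h9
    · have := h11 (n - 11)
      rwa [Nat.sub_add_cancel h] at this

/-! ### The ideals 𝔪², I, Iⁿ and 𝔪Iⁿ as sets of exponents -/

namespace Ring479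

open semigroupRing

variable {k : Type*} [Field k]

theorem four_mem : 4 ∈ semigroup479 := (mem_semigroup479_iff 4).2 (by omega)

theorem mem_of_le (n : ℕ) (hn : 11 ≤ n) : n ∈ semigroup479 := (mem_semigroup479_iff n).2 (by omega)

theorem isNoetherianRing : IsNoetherianRing (Ring479 k) :=
  semigroupRing.isNoetherianRing (by norm_num) four_mem mem_of_le

theorem mem_iff {E : Set ℕ} (hE : ∀ e ∈ semigroup479, e ∈ E → ∀ h ∈ semigroup479, e + h ∈ E)
    (f : Ring479 k) : f ∈ monomialIdeal k semigroup479 E ↔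
      ∀ n, PowerSeries.coeff n (f : PowerSeries k) ≠ 0 → n ∈ E :=
  mem_monomialIdeal_iff (by norm_num) four_mem hE f

theorem maximalIdeal_eq :
    maximalIdeal (Ring479 k) = monomialIdeal k semigroup479 {n | n ≠ 0} :=
  semigroupRing.maximalIdeal_eq (by norm_num) four_mem

theorem maximalIdeal_sq_eq :
    maximalIdeal (Ring479 k) ^ 2 = monomialIdeal k semigroup479 {n | 8 ≤ n ∧ n ≠ 9} := by
  rw [sq, maximalIdeal_eq]
  refine monomialIdeal_mul_monomialIdeal ?_ ?_
  · intro a ha ha0 b hb hb0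
    rw [mem_semigroup479_iff] at ha hb
    simp only [Set.mem_ofPred_eq] at *
    omega
  · intro n hn hnE
    simp only [mem_semigroup479_iff, Set.mem_ofPred_eq] at *
    -- Subtracting 4 works except for 14, because 10 ∉ H.
    by_cases h4 : n = 14
    · exact ⟨7, by omega, by omega, 7, by omega, by omega, by omega⟩
    · exact ⟨4, by omega, by omega, n - 4, by omega, by omega, by omega⟩

theorem colon_eq {s : ℕ} (hs : s ∈ semigroup479) :
    (Ideal.span {tPow k s hs}).colon
      ((maximalIdeal (Ring479 k) ^ 2 : Ideal (Ring479 k)) : Set (Ring479 k)) =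
      monomialIdeal k semigroup479 {n | s ≤ n ∧ n ≠ s + 2} := by
  ext f
  rw [Submodule.mem_colon, maximalIdeal_sq_eq, mem_iff]
  · constructor
    · intro h n hn
      have hnH := mem_of_coeff_ne_zero f hn
      have key : ∀ a ∈ semigroup479, a ∈ {n | 8 ≤ n ∧ n ≠ 9} → ∃ h ∈ semigroup479, a + n = s + h := by
        intro a ha haE
        have h1 := h _ (tPow_mem_monomialIdeal ha haE)
        rw [smul_eq_mul, mul_comm, mem_span_tPow_iff] at h1
        refine h1 (a + n) ?_
        rw [coeff_tPow_mul, if_pos (by omega), Nat.add_sub_cancel_left]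
        exact hn
      -- Three exponents of 𝔪² suffice: 8 excludes n = s + 2, as 10 ∉ H, and 8, 11, 14 together
      -- exclude every n < s.
      obtain ⟨a, ha, h1⟩ := key 8 (mem_semigroup479_iff 8 |>.2 (by omega)) (by simp)
      obtain ⟨b, hb, h2⟩ := key 11 (mem_of_le _ (by omega)) (by simp)
      obtain ⟨c, hc, h3⟩ := key 14 (mem_of_le _ (by omega)) (by simp)
      rw [mem_semigroup479_iff] at ha hb hc
      simp only [Set.mem_ofPred_eq]
      omega
    · intro h p hp
      rw [SetLike.mem_coe, mem_iff] at hp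
      · rw [smul_eq_mul, mem_span_tPow_iff]
        intro n hn
        obtain ⟨a, b, rfl, ha, hb⟩ := exists_of_coeff_mul_ne_zero hn
        have h1 := h a ha
        have h2 := hp b hb
        have h3 := mem_of_coeff_ne_zero f ha
        have h4 := mem_of_coeff_ne_zero p hb
        rw [mem_semigroup479_iff] at h3 h4
        simp only [Set.mem_ofPred_eq] at h1 h2
        exact ⟨a + b - s, (mem_semigroup479_iff _).2 (by omega), by omega⟩
      · intro e he heE a ha
        rw [mem_semigroup479_iff] at he ha
        simp only [Set.mem_ofPred_eq] at *
        omega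
  · intro e he heE a ha
    rw [mem_semigroup479_iff] at he ha hs
    simp only [Set.mem_ofPred_eq] at *
    omega

/-- The exponents of `I ^ n` for `s ∈ {4, 9}`. -/
def powExp (s n : ℕ) : Set ℕ := {e | n = 0 ∨ e = n * s ∨ n * s + 3 ≤ e}

/-- The exponents of `I ^ n` for `s ∉ {4, 9}`. -/
def powExp' (s n : ℕ) : Set ℕ :=
  {e | n * s ≤ e ∧ ¬ (n = 1 ∧ e = s + 2) ∧ ¬ (s = 7 ∧ n = 2 ∧ e = 17)}

/-- The exponents of `𝔪 I ^ n` for `s = 9`. -/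
def fiberExp (s n : ℕ) : Set ℕ := {e | e = n * s + 4 ∨ n * s + 7 ≤ e}

/-- The exponents of `𝔪 I ^ n` for `s ∉ {4, 9}`. -/
def fiberExp' (s n : ℕ) : Set ℕ := {e | n * s + 4 ≤ e ∧ ¬ (n = 1 ∧ e = s + 6)}

theorem powExp_closed {s : ℕ} (n : ℕ) : ∀ e ∈ semigroup479, e ∈ powExp s n →
    ∀ h ∈ semigroup479, e + h ∈ powExp s n := by
  intro e he heE h hh
  simp only [mem_semigroup479_iff, powExp, Set.mem_ofPred_eq] at *
  omega

theorem powExp'_closed {s : ℕ} (n : ℕ) :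
    ∀ e ∈ semigroup479, e ∈ powExp' s n → ∀ h ∈ semigroup479, e + h ∈ powExp' s n := by
  intro e he heE h hh
  simp only [mem_semigroup479_iff, powExp', Set.mem_ofPred_eq] at *
  rcases n with - | - | - | n <;> omega

theorem fiberExp_closed {s : ℕ} (n : ℕ) : ∀ e ∈ semigroup479, e ∈ fiberExp s n →
    ∀ h ∈ semigroup479, e + h ∈ fiberExp s n := by
  intro e he heE h hh
  simp only [mem_semigroup479_iff, fiberExp, Set.mem_ofPred_eq] at *
  omega

theorem fiberExp'_closed {s : ℕ} (n : ℕ) :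
    ∀ e ∈ semigroup479, e ∈ fiberExp' s n → ∀ h ∈ semigroup479, e + h ∈ fiberExp' s n := by
  intro e he heE h hh
  simp only [mem_semigroup479_iff, fiberExp', Set.mem_ofPred_eq] at *
  rcases n with - | - | n <;> omega

theorem monomialIdeal_congr {D E : Set ℕ} (h : ∀ n ∈ semigroup479, n ∈ D ↔ n ∈ E) :
    monomialIdeal k semigroup479 D = monomialIdeal k semigroup479 E := by
  rw [monomialIdeal, monomialIdeal]
  congr 1
  ext f
  exact ⟨fun ⟨e, he, heD, hf⟩ => ⟨e, he, (h e he).1 heD, hf⟩,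
    fun ⟨e, he, heE, hf⟩ => ⟨e, he, (h e he).2 heE, hf⟩⟩

variable {I : Ideal (Ring479 k)} {s : ℕ}

theorem pow_eq (hs : s = 4 ∨ s = 9)
    (hI : I = monomialIdeal k semigroup479 {n | s ≤ n ∧ n ≠ s + 2}) (n : ℕ) :
    I ^ n = monomialIdeal k semigroup479 (powExp s n) := by
  refine pow_eq_monomialIdeal ?_ ?_ ?_ ?_ n
  · rw [hI]
    refine monomialIdeal_congr fun e he => ?_
    simp only [mem_semigroup479_iff, powExp, Set.mem_ofPred_eq] at *
    omega
  · intro e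
    simp [powExp]
  · intro n a ha haE b hb hbE
    simp only [mem_semigroup479_iff, powExp, Set.mem_ofPred_eq] at *
    rcases hs with rfl | rfl <;> omega
  · intro n e he heE
    simp only [mem_semigroup479_iff, powExp, Set.mem_ofPred_eq] at *
    rcases n with - | n
    · exact ⟨0, by omega, by omega, e, by omega, by omega, by omega⟩
    · rcases hs with rfl | rfl
      -- Splitting off (n + 1) · 4 would leave 10 ∉ H here, so 7 is split off instead.
      · by_cases h1 : e = (n + 2) * 4 + 6
        · exact ⟨e - 7, by omega, by omega, 7, by omega, by omega, by omega⟩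
        · by_cases h2 : e = (n + 2) * 4
          · exact ⟨e - 4, by omega, by omega, 4, by omega, by omega, by omega⟩
          · exact ⟨(n + 1) * 4, by omega, by omega, e - (n + 1) * 4, by omega, by omega, by omega⟩
      · exact ⟨e - 9, by omega, by omega, 9, by omega, by omega, by omega⟩

theorem pow_eq' (hs : s = 7 ∨ s = 8 ∨ 11 ≤ s)
    (hI : I = monomialIdeal k semigroup479 {n | s ≤ n ∧ n ≠ s + 2}) (n : ℕ) :
    I ^ n = monomialIdeal k semigroup479 (powExp' s n) := by
  refine pow_eq_monomialIdeal ?_ ?_ ?_ ?_ n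
  · rw [hI]
    refine monomialIdeal_congr fun e he => ?_
    simp only [mem_semigroup479_iff, powExp', Set.mem_ofPred_eq, true_and] at *
    omega
  · intro e
    simp [powExp']
  · intro n a ha haE b hb hbE
    simp only [mem_semigroup479_iff, powExp', Set.mem_ofPred_eq, true_and] at *
    have h1 : (n + 1) * s = n * s + s := by ring
    rcases n with - | - | n <;> omega
  · intro n e he heE
    simp only [mem_semigroup479_iff, powExp', Set.mem_ofPred_eq, true_and] at *
    have h1 : (n + 1) * s = n * s + s := by ring
    rcases n with - | n
    · exact ⟨0, by omega, by omega, e, by omega, by omega, by omega⟩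
    · have h2 : (n + 1) * s = n * s + s := by ring
      have h4 : n = 0 ∧ n * s = 0 ∨ s ≤ n * s :=
        (Nat.eq_zero_or_pos n).imp (fun h => ⟨h, by simp [h]⟩) (Nat.le_mul_of_pos_left s)
      clear he
      obtain ⟨r, rfl⟩ : ∃ r, e = (n + 1) * s + s + r := ⟨e - ((n + 1) * s + s), by omega⟩
      -- The summand s + r is unavailable in these cases: s + 2 is excluded from I, and 7 + 3 ∉ H.
      -- Then s + 1, which is in H, replaces it; this is how the gap s + 2 of I closes in I².
      by_cases h3 : r = 2 ∨ (s = 7 ∧ r = 3)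
      · refine ⟨(n + 1) * s + (r - 1), by omega, ?_, s + 1, by omega, by omega, by omega⟩
        rcases n with - | - | n <;> omega
      · refine ⟨(n + 1) * s, by omega, ?_, s + r, by clear heE; omega, by omega, by omega⟩
        rcases n with - | - | n <;> omega

theorem isMonomialFiltration {I J : Ideal (Ring479 k)} {E D : ℕ → Set ℕ}
    (hI : ∀ n, I ^ n = monomialIdeal k semigroup479 (E n))
    (hJ : ∀ n, J * I ^ n = monomialIdeal k semigroup479 (D n))
    (hE : ∀ n, ∀ e ∈ semigroup479, e ∈ E n → ∀ h ∈ semigroup479, e + h ∈ E n)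
    (hD : ∀ n, ∀ e ∈ semigroup479, e ∈ D n → ∀ h ∈ semigroup479, e + h ∈ D n) :
    IsMonomialFiltration I J E D where
  mem_pow_iff n f := by rw [hI, mem_iff (hE n)]
  mem_mul_pow_iff n f := by rw [hJ, mem_iff (hD n)]

theorem isMonomialFiltration_self (hs : s = 4 ∨ s = 9)
    (hI : I = monomialIdeal k semigroup479 {n | s ≤ n ∧ n ≠ s + 2}) :
    IsMonomialFiltration I I (powExp s) (fun n => powExp s (n + 1)) :=
  isMonomialFiltration (pow_eq hs hI) (fun n => by rw [← pow_succ', pow_eq hs hI])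
    powExp_closed (fun n => powExp_closed (n + 1))

theorem isMonomialFiltration_self' (hs : s = 7 ∨ s = 8 ∨ 11 ≤ s)
    (hI : I = monomialIdeal k semigroup479 {n | s ≤ n ∧ n ≠ s + 2}) :
    IsMonomialFiltration I I (powExp' s) (fun n => powExp' s (n + 1)) :=
  isMonomialFiltration (pow_eq' hs hI) (fun n => by rw [← pow_succ', pow_eq' hs hI])
    powExp'_closed (fun n => powExp'_closed (n + 1))

/-- The excluded exponent 6 is not in H. So for s = 4 the fiber cone is the associated graded ring
of 𝔪. -/
theorem eq_maximalIdeal (hI : I = monomialIdeal k semigroup479 {n | 4 ≤ n ∧ n ≠ 4 + 2}) :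
    I = maximalIdeal (Ring479 k) := by
  rw [hI, maximalIdeal_eq]
  refine monomialIdeal_congr fun n hn => ?_
  rw [mem_semigroup479_iff] at hn
  simp only [Set.mem_ofPred_eq]
  omega

theorem isMonomialFiltration_maximalIdeal (hs : s = 9)
    (hI : I = monomialIdeal k semigroup479 {n | s ≤ n ∧ n ≠ s + 2}) :
    IsMonomialFiltration I (maximalIdeal (Ring479 k)) (powExp s) (fiberExp s) := by
  refine isMonomialFiltration (pow_eq (.inr hs) hI) (fun n => ?_) powExp_closed fiberExp_closed
  subst hs
  rw [maximalIdeal_eq, pow_eq (.inr rfl) hI]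
  refine monomialIdeal_mul_monomialIdeal ?_ ?_
  · intro a ha ha0 b hb hbE
    simp only [mem_semigroup479_iff, powExp, fiberExp, Set.mem_ofPred_eq] at *
    omega
  · intro e he heD
    simp only [mem_semigroup479_iff, powExp, fiberExp, Set.mem_ofPred_eq] at *
    rcases n with - | n
    · exact ⟨e, by omega, by omega, 0, by omega, by omega, by omega⟩
    · exact ⟨4, by omega, by omega, e - 4, by omega, by omega, by omega⟩

theorem isMonomialFiltration_maximalIdeal' (hs : s = 7 ∨ s = 8 ∨ 11 ≤ s)
    (hI : I = monomialIdeal k semigroup479 {n | s ≤ n ∧ n ≠ s + 2}) :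
    IsMonomialFiltration I (maximalIdeal (Ring479 k)) (powExp' s) (fiberExp' s) := by
  refine isMonomialFiltration (pow_eq' hs hI) (fun n => ?_) powExp'_closed fiberExp'_closed
  rw [maximalIdeal_eq, pow_eq' hs hI]
  refine monomialIdeal_mul_monomialIdeal ?_ ?_
  · intro a ha ha0 b hb hbE
    simp only [mem_semigroup479_iff, powExp', fiberExp', Set.mem_ofPred_eq] at *
    rcases n with - | - | - | n <;> omega
  · intro e he heD
    simp only [mem_semigroup479_iff, powExp', fiberExp', Set.mem_ofPred_eq] at *
    rcases n with - | n
    · exact ⟨e, by omega, by omega, 0, by omega, by omega, by omega⟩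
    · have h2 : (n + 1) * s = n * s + s := by ring
      have h4 : n = 0 ∧ n * s = 0 ∨ s ≤ n * s :=
        (Nat.eq_zero_or_pos n).imp (fun h => ⟨h, by simp [h]⟩) (Nat.le_mul_of_pos_left s)
      clear he
      -- Removing 4 would give 10 ∉ H, respectively the gap 17 of I².
      by_cases h3 : s = 7 ∧ (n = 0 ∧ e = 14 ∨ n = 1 ∧ e = 21)
      · obtain ⟨rfl, ⟨rfl, rfl⟩ | ⟨rfl, rfl⟩⟩ := h3
        · exact ⟨7, by omega, by omega, 7, by omega, by omega, by omega⟩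
        · exact ⟨7, by omega, by omega, 14, by omega, by omega, by omega⟩
      · refine ⟨4, by omega, by omega, e - 4, ?_, ?_, by omega⟩
        · rcases n with - | - | n <;> omega
        · rcases n with - | - | n <;> omega

/-! ### Cohen–Macaulay and Buchsbaum properties of G(I) and F(I), by the value of s -/

theorem assocGraded_isReesQuotient {E : ℕ → Set ℕ} (hs : s ∈ semigroup479)
    (h : IsMonomialFiltration I I E (fun n => E (n + 1))) {c : ℕ} (hJ : ∀ e, c ≤ e → e ∈ E 1)
    (hsE : s ∈ E 1) (hE : ∀ e ∈ semigroup479, e ∈ E 1 → s ≤ e) (hD : ∀ n, n * s ∉ E (n + 1)) :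
    IsReesQuotient (R := AssocGradedRing I) k I I (tPow k s hs) (reesToAssocGraded I) :=
  h.isReesQuotient (by norm_num) four_mem mem_of_le (reesToAssocGraded_surjective I)
    (reesToAssocGraded_eq_zero_iff I) hJ hsE hE hD

theorem fiberCone_isReesQuotient {E D : ℕ → Set ℕ} (hs : s ∈ semigroup479)
    (h : IsMonomialFiltration I (maximalIdeal (Ring479 k)) E D) {c : ℕ}
    (hJ : ∀ e, c ≤ e → e ∈ D 0) (hsE : s ∈ E 1)
    (hE : ∀ e ∈ semigroup479, e ∈ E 1 → s ≤ e) (hD : ∀ n, n * s ∉ D n) :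
    IsReesQuotient (R := FiberCone I) k I (maximalIdeal (Ring479 k)) (tPow k s hs)
      (Ideal.Quotient.mk _) :=
  h.isReesQuotient (by norm_num) four_mem mem_of_le Ideal.Quotient.mk_surjective
    (fun p => by rw [Ideal.Quotient.eq_zero_iff_mem, mem_map_algebraMap_reesAlgebra_iff])
    hJ hsE hE hD

theorem isNoetherianRing_assocGradedRing : IsNoetherianRing (AssocGradedRing I) :=
  have := isNoetherianRing (k := k)
  isNoetherianRing_of_surjective _ _ (reesToAssocGraded I) (reesToAssocGraded_surjective I)

theorem isNoetherianRing_fiberCone : IsNoetherianRing (FiberCone I) :=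
  have := isNoetherianRing (k := k)
  inferInstance

/-- For n ≥ 1 the exponent conditions for successive powers are translates by s, so multiplication
by t^s T is injective. -/
theorem assocGradedRing_of_four_or_nine (hs : s ∈ semigroup479) (h49 : s = 4 ∨ s = 9)
    (hI : I = monomialIdeal k semigroup479 {n | s ≤ n ∧ n ≠ s + 2}) :
    IsCohenMacaulayRing (AssocGradedRing I) ∧ IsBuchsbaumRing (AssocGradedRing I) := by
  have h := isMonomialFiltration_self h49 hI
  have := isNoetherianRing_assocGradedRing (I := I)
  have hφ := assocGraded_isReesQuotient hs h (c := s + 3)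
    (fun e he => by simp only [powExp, Set.mem_ofPred_eq]; omega)
    (by simp only [powExp, Set.mem_ofPred_eq]; omega)
    (fun e _ he => by simp only [powExp, Set.mem_ofPred_eq] at he; omega)
    (fun n => by simp only [powExp, Set.mem_ofPred_eq]; rcases h49 with rfl | rfl <;> omega)
  constructor
  · refine h.isCohenMacaulayRing hφ fun n e he heE heD => ?_
    simp only [mem_semigroup479_iff, powExp, Set.mem_ofPred_eq] at *
    rcases h49 with rfl | rfl <;> omega
  · refine h.isBuchsbaumRing hφ fun n e he j heE heD => ?_
    simp only [mem_semigroup479_iff, powExp, Set.mem_ofPred_eq] at *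
    rcases h49 with rfl | rfl <;> exact ⟨fun a ha ha0 => by omega, fun a ha ha0 => by omega⟩

theorem fiberCone_of_four (hs : s ∈ semigroup479) (h4 : s = 4)
    (hI : I = monomialIdeal k semigroup479 {n | s ≤ n ∧ n ≠ s + 2}) :
    IsCohenMacaulayRing (FiberCone I) ∧ IsBuchsbaumRing (FiberCone I) := by
  have h : IsMonomialFiltration I (maximalIdeal (Ring479 k)) (powExp s)
      (fun n => powExp s (n + 1)) := by
    have h1 := isMonomialFiltration_self (.inl h4) hI
    subst h4
    have h2 := eq_maximalIdeal hI
    convert h1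
    exact h2.symm
  have := isNoetherianRing_fiberCone (I := I)
  have hφ := fiberCone_isReesQuotient hs h (c := s + 3)
    (fun e he => by simp only [powExp, Set.mem_ofPred_eq]; omega)
    (by simp only [powExp, Set.mem_ofPred_eq]; omega)
    (fun e _ he => by simp only [powExp, Set.mem_ofPred_eq] at he; omega)
    (fun n => by simp only [powExp, Set.mem_ofPred_eq]; subst h4; omega)
  constructor
  · refine h.isCohenMacaulayRing hφ fun n e he heE heD => ?_
    simp only [mem_semigroup479_iff, powExp, Set.mem_ofPred_eq] at *
    subst h4
    omega
  · refine h.isBuchsbaumRing hφ fun n e he j heE heD => ?_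
    simp only [mem_semigroup479_iff, powExp, Set.mem_ofPred_eq] at *
    subst h4
    exact ⟨fun a ha ha0 => by omega, fun a ha ha0 => by omega⟩

theorem fiberCone_of_nine (hs : s ∈ semigroup479) (h9 : s = 9)
    (hI : I = monomialIdeal k semigroup479 {n | s ≤ n ∧ n ≠ s + 2}) :
    IsCohenMacaulayRing (FiberCone I) ∧ IsBuchsbaumRing (FiberCone I) := by
  have h := isMonomialFiltration_maximalIdeal h9 hI
  have := isNoetherianRing_fiberCone (I := I)
  have hφ := fiberCone_isReesQuotient hs h (c := 7)
    (fun e he => by simp only [fiberExp, Set.mem_ofPred_eq]; omega)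
    (by simp only [powExp, Set.mem_ofPred_eq]; omega)
    (fun e _ he => by simp only [powExp, Set.mem_ofPred_eq] at he; omega)
    (fun n => by simp only [fiberExp, Set.mem_ofPred_eq]; omega)
  constructor
  · refine h.isCohenMacaulayRing hφ fun n e he heE heD => ?_
    simp only [mem_semigroup479_iff, powExp, fiberExp, Set.mem_ofPred_eq] at *
    subst h9
    omega
  · refine h.isBuchsbaumRing hφ fun n e he j heE heD => ?_
    simp only [mem_semigroup479_iff, powExp, fiberExp, Set.mem_ofPred_eq] at *
    subst h9
    exact ⟨fun a ha ha0 => by omega, fun a ha ha0 => by omega⟩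

theorem fiberCone_of_other (hs : s ∈ semigroup479) (hs' : s = 7 ∨ s = 8 ∨ 11 ≤ s)
    (hI : I = monomialIdeal k semigroup479 {n | s ≤ n ∧ n ≠ s + 2}) :
    ¬ IsCohenMacaulayRing (FiberCone I) ∧ IsBuchsbaumRing (FiberCone I) := by
  have h := isMonomialFiltration_maximalIdeal' hs' hI
  have := isNoetherianRing_fiberCone (I := I)
  have hφ := fiberCone_isReesQuotient hs h (c := 4)
    (fun e he => by simp only [fiberExp', Set.mem_ofPred_eq]; omega)
    (by simp only [powExp', Set.mem_ofPred_eq]; omega)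
    (fun e _ he => by simp only [powExp', Set.mem_ofPred_eq] at he; omega)
    (fun n => by simp only [fiberExp', Set.mem_ofPred_eq]; omega)
  constructor
  -- Since s + 2 is missing from I, 𝔪I misses (s + 2) + 4. The class of t^(s+6) T is a nonzero socle
  -- element.
  · refine h.not_isCohenMacaulayRing hφ 1 (s + 6) ?_ ?_ ?_ ?_ ?_
    · rw [mem_semigroup479_iff]
      omega
    · simp only [powExp', Set.mem_ofPred_eq]
      omega
    · simp [fiberExp']
    · intro a ha ha0
      simp only [mem_semigroup479_iff, fiberExp', Set.mem_ofPred_eq, true_and] at *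
      omega
    · intro a ha haE
      simp only [mem_semigroup479_iff, powExp', fiberExp', Set.mem_ofPred_eq, true_and] at *
      omega
  · refine h.isBuchsbaumRing hφ fun n e he j heE heD => ?_
    simp only [mem_semigroup479_iff, powExp', fiberExp', Set.mem_ofPred_eq, true_and] at *
    rw [Nat.add_mul] at heD
    -- A torsion exponent satisfies this bound, so its class can be nonzero only for n = 1 and e = s
    -- + 6, the socle element above.
    have key : n * s + 4 ≤ e := by omega
    clear heE heD
    have h2 : (n + 1) * s = n * s + s := by ring
    exact ⟨fun a ha ha0 => by clear he; rcases n with - | - | n <;> omega,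
      fun a ha ha0 => by rcases n with - | - | n <;> omega⟩

/-- The excluded exponent s + 2 = 10 is not in H, so Iⁿ contains every exponent of H from 8n on and
no torsion arises. -/
theorem assocGradedRing_of_eight (hs : s ∈ semigroup479) (h8 : s = 8)
    (hI : I = monomialIdeal k semigroup479 {n | s ≤ n ∧ n ≠ s + 2}) :
    IsCohenMacaulayRing (AssocGradedRing I) ∧ IsBuchsbaumRing (AssocGradedRing I) := by
  have h := isMonomialFiltration_self' (.inr (.inl h8)) hI
  have := isNoetherianRing_assocGradedRing (I := I)
  have hφ := assocGraded_isReesQuotient hs h (c := s + 3)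
    (fun e he => by simp only [powExp', Set.mem_ofPred_eq]; omega)
    (by simp only [powExp', Set.mem_ofPred_eq]; omega)
    (fun e _ he => by simp only [powExp', Set.mem_ofPred_eq] at he; omega)
    (fun n => by simp only [powExp', Set.mem_ofPred_eq]; subst h8; omega)
  constructor
  · refine h.isCohenMacaulayRing hφ fun n e he heE heD => ?_
    simp only [mem_semigroup479_iff, powExp', Set.mem_ofPred_eq] at *
    subst h8
    omega
  · refine h.isBuchsbaumRing hφ fun n e he j heE heD => ?_
    simp only [mem_semigroup479_iff, powExp', Set.mem_ofPred_eq] at *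
    subst h8
    exact ⟨fun a ha ha0 => by omega, fun a ha ha0 => by omega⟩

theorem assocGradedRing_of_seven (hs : s ∈ semigroup479) (h7 : s = 7)
    (hI : I = monomialIdeal k semigroup479 {n | s ≤ n ∧ n ≠ s + 2}) :
    ¬ IsCohenMacaulayRing (AssocGradedRing I) ∧ ¬ IsBuchsbaumRing (AssocGradedRing I) := by
  have h := isMonomialFiltration_self' (.inl h7) hI
  have hφ := assocGraded_isReesQuotient hs h (c := s + 3)
    (fun e he => by simp only [powExp', Set.mem_ofPred_eq]; omega)
    (by simp only [powExp', Set.mem_ofPred_eq]; omega)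
    (fun e _ he => by simp only [powExp', Set.mem_ofPred_eq] at he; omega)
    (fun n => by simp only [powExp', Set.mem_ofPred_eq]; subst h7; omega)
  subst h7
  constructor
  -- The gap 17 of I² makes t^17 T a nonzero socle element.
  · refine h.not_isCohenMacaulayRing hφ 1 17 ?_ ?_ ?_ ?_ ?_
    · rw [mem_semigroup479_iff]
      omega
    · simp [powExp']
    · simp [powExp']
    · intro a ha ha0
      simp only [mem_semigroup479_iff, powExp', Set.mem_ofPred_eq] at *
      omega
    · intro a ha haE
      simp only [mem_semigroup479_iff, powExp', Set.mem_ofPred_eq, true_and] at *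
      omega
  -- The class of t^9 in degree zero is killed by t^7 T, as 16 = 8 + 8 is an exponent of I², but not
  -- by t^8 T, as 17 is not.
  · refine h.not_isBuchsbaumRing hφ 0 9 8 1 ?_ ?_ ?_ ?_ one_ne_zero ?_ ?_
    · rw [mem_semigroup479_iff]
      omega
    · simp [powExp']
    · rw [mem_semigroup479_iff]
      omega
    · simp [powExp']
    · simp [powExp']
    · simp [powExp']

theorem assocGradedRing_of_le (hs : s ∈ semigroup479) (h11 : 11 ≤ s)
    (hI : I = monomialIdeal k semigroup479 {n | s ≤ n ∧ n ≠ s + 2}) :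
    ¬ IsCohenMacaulayRing (AssocGradedRing I) ∧ IsBuchsbaumRing (AssocGradedRing I) := by
  have h := isMonomialFiltration_self' (.inr (.inr h11)) hI
  have := isNoetherianRing_assocGradedRing (I := I)
  have hφ := assocGraded_isReesQuotient hs h (c := s + 3)
    (fun e he => by simp only [powExp', Set.mem_ofPred_eq]; omega)
    (by simp only [powExp', Set.mem_ofPred_eq]; omega)
    (fun e _ he => by simp only [powExp', Set.mem_ofPred_eq] at he; omega)
    (fun n => by simp only [powExp', Set.mem_ofPred_eq, Nat.add_mul]; omega)
  constructor
  -- Now s + 2 ∈ H, and the class of t^(s+2) in A/I is a socle element of G(I).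
  · refine h.not_isCohenMacaulayRing hφ 0 (s + 2) ?_ ?_ ?_ ?_ ?_
    · rw [mem_semigroup479_iff]
      omega
    · simp [powExp']
    · simp [powExp']
    · intro a ha ha0
      simp only [mem_semigroup479_iff, powExp', Set.mem_ofPred_eq, true_and] at *
      omega
    · intro a ha haE
      simp only [mem_semigroup479_iff, powExp', Set.mem_ofPred_eq, true_and] at *
      omega
  · refine h.isBuchsbaumRing hφ fun n e he j heE heD => ?_
    simp only [mem_semigroup479_iff, powExp', Set.mem_ofPred_eq, true_and] at *
    have h1 : (n + j + 1) * s = n * s + j * s + s := by ring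
    have h2 : (n + 1) * s = n * s + s := by ring
    have h3 : (n + 1 + 1) * s = n * s + s + s := by ring
    -- So a nonzero torsion monomial must have n = 0 and e = s + 2.
    have key : (n + 1) * s ≤ e := by omega
    clear heE heD
    exact ⟨fun a ha ha0 => by clear he; rcases n with - | - | n <;> omega,
      fun a ha ha0 => by clear he; rcases n with - | - | n <;> omega⟩

end Ring479

/-! ### Infinite injective dimension -/

section InjectiveDimension

universe u

open CategoryTheory Abelian

variable {A : Type u} [CommRing A] [IsDomain A] {x : A}

/-- If the quotient `A / (x)` of a domain has a submodule `N` with a retract `(A / (x)) / N`,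
and there is a homomorphism `N → A / (x)` that does not extend to `A / (x)`, then `A` has infinite
injective dimension. -/
theorem not_hasInjectiveDimensionLT (hx : x ≠ 0) {N K : Type u} [AddCommGroup N] [Module A N]
    [AddCommGroup K] [Module A K] (ι : N →ₗ[A] A ⧸ Ideal.span {x}) (π : A ⧸ Ideal.span {x} →ₗ[A] K)
    (hι : Function.Injective ι) (hexact : Function.Exact ι π) (hπ : Function.Surjective π)
    (i : K →ₗ[A] N) (r : N →ₗ[A] K) (hri : r ∘ₗ i = LinearMap.id)
    (φ : N →ₗ[A] A ⧸ Ideal.span {x}) (hφ : ∀ ψ, ψ ∘ₗ ι ≠ φ) (n : ℕ) :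
    ¬ HasInjectiveDimensionLT (ModuleCat.of A A) n := by
  intro hinj
  let B : ModuleCat.{u} A := ModuleCat.of A (A ⧸ Ideal.span {x})
  let S : ShortComplex (ModuleCat.{u} A) := ShortComplex.mk
    (X₁ := ModuleCat.of A A) (X₂ := ModuleCat.of A A) (X₃ := B)
    (ModuleCat.ofHom (LinearMap.lsmul A A x)) (ModuleCat.ofHom (Ideal.span {x}).mkQ) (by
      ext
      simp only [ModuleCat.hom_comp, ModuleCat.hom_ofHom, LinearMap.comp_apply,
        LinearMap.lsmul_apply, smul_eq_mul, mul_one, ModuleCat.hom_zero, LinearMap.zero_apply]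
      exact (Submodule.Quotient.mk_eq_zero _).2 (Ideal.mem_span_singleton_self x))
  let T : ShortComplex (ModuleCat.{u} A) := ShortComplex.mk
    (X₁ := ModuleCat.of A N) (X₂ := B) (X₃ := ModuleCat.of A K)
    (ModuleCat.ofHom ι) (ModuleCat.ofHom π) (by
      ext y
      exact hexact.apply_apply_eq_zero y)
  have hS : S.ShortExact := by
    refine ModuleCat.shortComplex_shortExact S ?_ ?_ ?_
    · intro y
      constructor
      · intro hy
        obtain ⟨z, hz⟩ := Ideal.mem_span_singleton'.1 ((Submodule.Quotient.mk_eq_zero _).1 hy)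
        exact ⟨z, by rw [← hz]; exact mul_comm x z⟩
      · rintro ⟨z, rfl⟩
        exact (Submodule.Quotient.mk_eq_zero _).2
          (Ideal.mul_mem_right z _ (Ideal.mem_span_singleton_self x))
    · exact fun y z hyz => mul_left_cancel₀ hx hyz
    · exact Submodule.mkQ_surjective _
  have hT : T.ShortExact := ModuleCat.shortComplex_shortExact T hexact hι hπ
  have hA : Projective (ModuleCat.of A A) := inferInstance
  -- B = A/(x) has the free resolution 0 → A → A of length one.
  have hB : ∀ (j : ℕ) (e : Ext B (ModuleCat.of A A) (j + 2)), e = 0 := by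
    intro j e
    obtain ⟨e', he'⟩ := Ext.contravariant_sequence_exact₃ hS (ModuleCat.of A A) e
      (Ext.eq_zero_of_projective (n := j + 1) _) (n₀ := j + 1) (by omega)
    rw [← he', Ext.eq_zero_of_projective (n := j) e', Ext.comp_zero]
  -- From 0 → N → B → K → 0, vanishing of Ext^(j+3)(K, A) and Ext^(j+2)(B, A) gives that of
  -- Ext^(j+2)(N, A), and K is a direct summand of N.
  have hdown : ∀ j : ℕ, (∀ e : Ext (ModuleCat.of A K) (ModuleCat.of A A) (j + 3), e = 0) →
      ∀ e : Ext (ModuleCat.of A K) (ModuleCat.of A A) (j + 2), e = 0 := by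
    intro j hj e
    have h1 : (Ext.mk₀ (ModuleCat.ofHom r)).comp e (zero_add _) = 0 := by
      obtain ⟨e', he'⟩ := Ext.contravariant_sequence_exact₁ hT (ModuleCat.of A A)
        ((Ext.mk₀ (ModuleCat.ofHom r)).comp e (zero_add _)) (n₁ := j + 3) (by omega) (hj _)
      rw [← he', hB j e', Ext.comp_zero]
    have h2 : ModuleCat.ofHom i ≫ ModuleCat.ofHom r = 𝟙 (ModuleCat.of A K) := by
      rw [← ModuleCat.ofHom_comp, hri]
      rfl
    rw [← Ext.mk₀_id_comp e, ← h2, ← Ext.mk₀_comp_mk₀_assoc, h1, Ext.comp_zero]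
  have htwo : ∀ e : Ext (ModuleCat.of A K) (ModuleCat.of A A) 2, e = 0 := by
    have hall : ∀ m j : ℕ, n ≤ j + m →
        ∀ e : Ext (ModuleCat.of A K) (ModuleCat.of A A) (j + 2), e = 0 := by
      intro m
      induction m with
      | zero =>
        intro j hj e
        exact e.eq_zero_of_hasInjectiveDimensionLT n (by omega)
      | succ m ih =>
        intro j hj
        exact hdown j (ih (j + 1) (by omega))
    exact hall n 0 (by omega)
  -- As Ext²(K, A) = 0, the class in Ext¹(N, A) corresponding to φ is the restriction of a class e
  -- in Ext¹(B, A).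
  obtain ⟨e, he⟩ := Ext.contravariant_sequence_exact₁ hT (ModuleCat.of A A)
    (n₀ := 1) ((Ext.mk₀ (ModuleCat.ofHom φ)).comp hS.extClass (zero_add 1)) (n₁ := 2) rfl (htwo _)
  have hxB : (x • 𝟙 B : B ⟶ B) = 0 := by
    refine ModuleCat.hom_ext (LinearMap.ext fun y => ?_)
    obtain ⟨y, rfl⟩ := Submodule.mkQ_surjective _ y
    change x • (Submodule.Quotient.mk y : A ⧸ Ideal.span {x}) = 0
    rw [← Submodule.Quotient.mk_smul, Submodule.Quotient.mk_eq_zero]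
    exact Ideal.mul_mem_right y _ (Ideal.mem_span_singleton_self x)
  -- Since x kills B it kills e, so e is the image of an endomorphism ψ of B under the connecting
  -- map.
  have hxe : e.comp (Ext.mk₀ S.f) (add_zero 1) = 0 := by
    have h1 : S.f = x • 𝟙 (ModuleCat.of A A) := by
      ext
      rfl
    rw [h1, ← Ext.smul_eq_comp_mk₀, ← Ext.mk₀_id_comp (x • e), Ext.comp_smul, ← Ext.smul_comp,
      ← Ext.mk₀_smul, hxB, Ext.mk₀_zero, Ext.zero_comp]
  obtain ⟨ψ, hψ⟩ := Ext.covariant_sequence_exact₁ B hS e hxe rfl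
  obtain ⟨ψ, rfl⟩ := (Ext.mk₀_bijective _ _).2 ψ
  have hdiff : (Ext.mk₀ (ModuleCat.ofHom φ - T.f ≫ ψ)).comp hS.extClass (zero_add 1) = 0 := by
    rw [sub_eq_add_neg, Ext.mk₀_add, Ext.mk₀_neg, Ext.add_comp, Ext.neg_comp,
      ← Ext.mk₀_comp_mk₀, ← he, ← hψ]
    rw [Ext.comp_assoc_of_second_deg_zero]
    exact add_neg_cancel _
  obtain ⟨θ, hθ⟩ := Ext.covariant_sequence_exact₃ _ hS _ rfl hdiff
  obtain ⟨θ, rfl⟩ := (Ext.mk₀_bijective _ _).2 θ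
  rw [Ext.mk₀_comp_mk₀] at hθ
  have hθ' := (Ext.mk₀_bijective _ _).1 hθ
  -- N is killed by x and A is a domain, so Hom(N, A) = 0; hence φ is the restriction of ψ, a
  -- contradiction.
  have hθ0 : θ = 0 := by
    ext y
    have hxy : x • ι y = 0 := by
      exact congrArg (fun f : B ⟶ B => f.hom (ι y)) hxB
    have : x • y = 0 := hι (by rw [map_smul, hxy, map_zero])
    have h2 : x * θ.hom y = 0 := by
      have h3 := θ.hom.map_smul x y
      rw [this, map_zero] at h3
      exact h3.symm
    exact (mul_eq_zero.1 h2).resolve_left hx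
  rw [hθ0, Limits.zero_comp, eq_comm, sub_eq_zero] at hθ'
  refine hφ ψ.hom ?_
  have := congrArg ModuleCat.Hom.hom hθ'
  exact this.symm

end InjectiveDimension

universe u

/-- If `R / 𝔪` splits off `𝔪 / aR` via `z` and a socle element `w` of `R / aR` is not a multiple of
`z` modulo `a`, then `R` has infinite injective dimension. -/
theorem not_hasInjectiveDimensionLT_of_split {A : Type u} [CommRing A] [IsDomain A] {m : Ideal A}
    {a z w : A} (ha0 : a ≠ 0) (ham : a ∈ m) (hz : z ∈ m) (c : A →+ A)
    (hc : ∀ b, ∀ f ∈ m, c (b * f) - b * c f ∈ m) (hcz : c z = 1)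
    (hca : ∀ f ∈ Ideal.span {a}, c f = 0)
    (hmz : ∀ f ∈ m, f * z ∈ Ideal.span {a}) (hmw : ∀ f ∈ m, f * w ∈ Ideal.span {a})
    (hzw : ∀ b, z * b - w ∉ Ideal.span {a}) (n : ℕ) :
    ¬ CategoryTheory.HasInjectiveDimensionLT (ModuleCat.of A A) n := by
  intro hn
  let q : Ideal A := Ideal.span {a}
  have hqm : q ≤ m := (Ideal.span_singleton_le_iff_mem _).2 ham
  let q' : Submodule A m := Submodule.comap m.subtype q
  -- The Ext criterion is applied to N = 𝔪/(a) and K = A/𝔪; the functional c gives the retraction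
  -- `r` onto K, with section 1 ↦ z.
  let ι : (m ⧸ q') →ₗ[A] A ⧸ q := q'.mapQ q m.subtype le_rfl
  let π : (A ⧸ q) →ₗ[A] A ⧸ m := Submodule.factor hqm
  let i : (A ⧸ m) →ₗ[A] m ⧸ q' := Submodule.liftQ m
    (LinearMap.toSpanSingleton A _ (q'.mkQ ⟨z, hz⟩)) fun f hf => by
      change f • q'.mkQ ⟨z, hz⟩ = 0
      rw [← map_smul]
      exact (Submodule.Quotient.mk_eq_zero q').2 (hmz f hf)
  let φ : m →ₗ[A] A ⧸ m :=
    { toFun f := Ideal.Quotient.mk m (c f)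
      map_add' f g := by rw [Submodule.coe_add, map_add, map_add]
      map_smul' b f := (Ideal.Quotient.eq.2 (hc b f f.2)).trans (map_mul _ _ _) }
  let r : (m ⧸ q') →ₗ[A] A ⧸ m := q'.liftQ φ fun f hf => by
    change Ideal.Quotient.mk m (c f) = 0
    rw [hca f hf, map_zero]
  let τ : (A ⧸ m) →ₗ[A] A ⧸ q := Submodule.liftQ m
    (LinearMap.toSpanSingleton A _ (q.mkQ w)) fun f hf => by
      change f • q.mkQ _ = 0
      rw [← map_smul]
      exact (Submodule.Quotient.mk_eq_zero q).2 (hmw f hf)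
  have hrz : r (q'.mkQ ⟨z, hz⟩) = Ideal.Quotient.mk m 1 := congrArg _ hcz
  refine not_hasInjectiveDimensionLT ha0 ι π ?_ ?_ ?_ i r ?_ (τ ∘ₗ r) ?_ n hn
  · rw [← LinearMap.ker_eq_bot, LinearMap.ker_eq_bot']
    intro y hy
    obtain ⟨y, rfl⟩ := q'.mkQ_surjective y
    exact (Submodule.Quotient.mk_eq_zero q').2 ((Submodule.Quotient.mk_eq_zero q).1 hy)
  · intro y
    obtain ⟨y, rfl⟩ := q.mkQ_surjective y
    constructor
    · intro hy
      exact ⟨q'.mkQ ⟨y, (Submodule.Quotient.mk_eq_zero m).1 hy⟩, rfl⟩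
    · rintro ⟨v, hv⟩
      obtain ⟨v, rfl⟩ := q'.mkQ_surjective v
      rw [← hv]
      exact (Submodule.Quotient.mk_eq_zero m).2 v.2
  · exact Submodule.factor_surjective hqm
  · ext
    change r ((1 : A) • q'.mkQ ⟨z, hz⟩) = _
    rw [one_smul, hrz]
    rfl
  -- An endomorphism of A/(a) is multiplication by some b, so an extension would send z to zb,
  -- whereas the given map sends z to w.
  · intro ψ hψ
    obtain ⟨b, hb⟩ := q.mkQ_surjective (ψ (q.mkQ 1))
    have h3 : (ψ ∘ₗ ι) (q'.mkQ ⟨z, hz⟩) = q.mkQ (z * b) := by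
      change ψ (q.mkQ z) = q.mkQ (z • b)
      rw [map_smul, hb, ← map_smul, ← map_smul, smul_eq_mul, mul_one]
    have h4 : (τ ∘ₗ r) (q'.mkQ ⟨z, hz⟩) = q.mkQ w := by
      rw [LinearMap.comp_apply, hrz]
      change (1 : A) • q.mkQ w = _
      rw [one_smul]
    rw [hψ, h4] at h3
    exact hzw b ((Submodule.Quotient.eq q).1 h3.symm)

/-! ### The semigroup ring is not Gorenstein -/

namespace Ring479

open semigroupRing

variable {k : Type*} [Field k]

theorem nine_mem : 9 ∈ semigroup479 := (mem_semigroup479_iff 9).2 (by omega)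

theorem coeff_eq_zero_of_mem_span {f : Ring479 k} (hf : f ∈ Ideal.span {tPow k 4 four_mem}) {a : ℕ}
    (h : a = 9 ∨ a = 14) : PowerSeries.coeff a (f : PowerSeries k) = 0 := by
  rw [mem_span_tPow_iff] at hf
  by_contra ha
  obtain ⟨b, hb, heq⟩ := hf a ha
  rw [mem_semigroup479_iff] at hb
  omega

/-- Adding any nonzero h ∈ H to 9 − 4 = 5 or 14 − 4 = 10 lands in H, so t^9 and t^14 are socle
elements modulo t^4. -/
theorem mul_tPow_mem_span {e : ℕ} (he : e ∈ semigroup479) (h : e = 9 ∨ e = 14) {f : Ring479 k}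
    (hf : f ∈ maximalIdeal (Ring479 k)) : f * tPow k e he ∈ Ideal.span {tPow k 4 four_mem} := by
  rw [mem_span_tPow_iff]
  intro n hn
  rw [mul_comm, coeff_tPow_mul] at hn
  split_ifs at hn with hle
  · have h1 := mem_of_coeff_ne_zero f hn
    have h2 := IsMonomialFiltration.coeff_ne_zero_of_mem hf hn
    refine ⟨n - 4, ?_, by omega⟩
    rw [mem_semigroup479_iff] at h1 ⊢
    omega
  · exact absurd rfl hn

/-- 9 is not a sum of two nonzero elements of H. Hence taking the coefficient of t^9 is an A-linear
map from 𝔪 to the residue field. -/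
theorem coeff_nine_mul (a : Ring479 k) {f : Ring479 k} (hf : f ∈ maximalIdeal (Ring479 k)) :
    PowerSeries.coeff 9 ((a * f : Ring479 k) : PowerSeries k) =
      PowerSeries.coeff 0 (a : PowerSeries k) * PowerSeries.coeff 9 (f : PowerSeries k) := by
  rw [MulMemClass.coe_mul, PowerSeries.coeff_mul, Finset.sum_eq_single (0, 9)]
  · rintro ⟨i, j⟩ hij hne
    rw [Finset.HasAntidiagonal.mem_antidiagonal] at hij
    by_contra h0
    have h1 := mem_of_coeff_ne_zero a (left_ne_zero_of_mul h0)
    have h2 := mem_of_coeff_ne_zero f (right_ne_zero_of_mul h0)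
    have h3 := IsMonomialFiltration.coeff_ne_zero_of_mem hf (right_ne_zero_of_mul h0)
    rw [mem_semigroup479_iff] at h1 h2
    simp only [ne_eq, Prod.mk.injEq] at *
    omega
  · simp

/-- The coefficient of `t ^ 9`, as a constant of the ring. -/
noncomputable def coeffNine : Ring479 k →+ Ring479 k where
  toFun f := algebraMap k _ (PowerSeries.coeff 9 (f : PowerSeries k))
  map_zero' := by rw [ZeroMemClass.coe_zero, map_zero, map_zero]
  map_add' f g := by rw [AddMemClass.coe_add, map_add, map_add]

theorem coeffNine_apply (f : Ring479 k) :
    coeffNine f = algebraMap k _ (PowerSeries.coeff 9 (f : PowerSeries k)) := rfl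

theorem coeffNine_mul_sub_mem (a : Ring479 k) {f : Ring479 k}
    (hf : f ∈ maximalIdeal (Ring479 k)) :
    coeffNine (a * f) - a * coeffNine f ∈ maximalIdeal (Ring479 k) := by
  rw [mem_maximalIdeal_iff, coeffNine_apply, coeffNine_apply, coeff_nine_mul a hf]
  change PowerSeries.coeff 0 (PowerSeries.C _ - (a : PowerSeries k) * PowerSeries.C _) = 0
  simp

theorem not_isGorensteinLocal : ¬ IsGorensteinLocal (Ring479 k) := by
  rintro ⟨-, n, hn⟩
  have h14 : (14 : ℕ) ∈ semigroup479 := mem_of_le 14 (by omega)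
  have h1 : ∀ b, ∀ f ∈ maximalIdeal (Ring479 k),
      coeffNine (b * f) - b * coeffNine f ∈ maximalIdeal (Ring479 k) :=
    fun b f hf => coeffNine_mul_sub_mem b hf
  have h2 : coeffNine (tPow k 9 nine_mem) = 1 := by
    rw [coeffNine_apply, coeff_tPow, if_pos rfl, map_one]
  have h3 : ∀ f ∈ Ideal.span {tPow k 4 four_mem}, coeffNine f = 0 := fun f hf => by
    rw [coeffNine_apply, coeff_eq_zero_of_mem_span hf (.inl rfl), map_zero]
  -- No multiple of t^9 has a term t^14, because 5 ∉ H.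
  have h4 : ∀ b, tPow k 9 nine_mem * b - tPow k 14 h14 ∉ Ideal.span {tPow k 4 four_mem} := by
    intro b hb
    have h2 := coeff_eq_zero_of_mem_span hb (.inr rfl)
    rw [AddSubgroupClass.coe_sub, map_sub, coeff_tPow_mul, coeff_tPow, if_pos rfl,
      if_pos (by norm_num), b.2 (14 - 9) (by rw [mem_semigroup479_iff]; omega)] at h2
    simp at h2
  exact not_hasInjectiveDimensionLT_of_split (A := Ring479 k) (m := maximalIdeal (Ring479 k))
    (tPow_ne_zero four_mem) (tPow_mem_maximalIdeal four_mem (by norm_num))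
    (tPow_mem_maximalIdeal nine_mem (by norm_num)) coeffNine h1 h2 h3
    (fun f hf => mul_tPow_mem_span nine_mem (.inl rfl) hf)
    (fun f hf => mul_tPow_mem_span h14 (.inr rfl) hf) h4 n hn

end Ring479

/-! ### Reduction numbers, and the comparison of I with 𝔪² and Q -/

theorem isReductionNumber_succ {R : Type*} [CommRing R] {Q I : Ideal R} {r : ℕ}
    (h : I ^ (r + 2) = Q * I ^ (r + 1)) (h' : I ^ (r + 1) ≠ Q * I ^ r) :
    IsReductionNumber Q I (r + 1) := by
  refine ⟨h, fun n hn => ?_⟩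
  by_contra hlt
  -- The equality persists to all larger exponents, so failure at r excludes every n ≤ r.
  have key : ∀ j, I ^ (n + j + 1) = Q * I ^ (n + j) := by
    intro j
    induction j with
    | zero => exact hn
    | succ j ih => rw [← add_assoc, pow_succ, ih, mul_assoc, ← pow_succ, ih]
  obtain ⟨j, rfl⟩ := Nat.exists_eq_add_of_le (Nat.lt_succ_iff.1 (not_le.1 hlt))
  exact h' (key j)

namespace Ring479

open semigroupRing

variable {k : Type*} [Field k] {I : Ideal (Ring479 k)} {s : ℕ}

theorem pow_succ_eq_span_mul_pow {E : ℕ → Set ℕ} (hs : s ∈ semigroup479)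
    (hI : ∀ n, I ^ n = monomialIdeal k semigroup479 (E n)) {n : ℕ}
    (h1 : ∀ b ∈ semigroup479, b ∈ E n → s + b ∈ E (n + 1))
    (h2 : ∀ e ∈ semigroup479, e ∈ E (n + 1) → ∃ b ∈ semigroup479, b ∈ E n ∧ s + b = e) :
    I ^ (n + 1) = Ideal.span {tPow k s hs} * I ^ n := by
  rw [span_tPow, hI, hI]
  refine (monomialIdeal_mul_monomialIdeal ?_ ?_).symm
  · rintro _ - rfl b hb hbE
    exact h1 b hb hbE
  · intro e he heE
    exact ⟨s, hs, rfl, h2 e he heE⟩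

theorem mem_of_tPow_mem_span_mul {E : Set ℕ} (hs : s ∈ semigroup479)
    (hE : ∀ e ∈ semigroup479, e ∈ E → ∀ h ∈ semigroup479, e + h ∈ E) {e : ℕ}
    (he : e ∈ semigroup479)
    (h : tPow k e he ∈ Ideal.span {tPow k s hs} * monomialIdeal k semigroup479 E) :
    s ≤ e ∧ e - s ∈ semigroup479 ∧ e - s ∈ E := by
  obtain ⟨z, hz, hze⟩ := Ideal.mem_span_singleton_mul.1 h
  have h1 := congrArg (fun f : Ring479 k => PowerSeries.coeff e (f : PowerSeries k)) hze
  simp only [coeff_tPow_mul, coeff_tPow, if_true] at h1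
  split_ifs at h1 with hle
  · have h2 : PowerSeries.coeff (e - s) (z : PowerSeries k) ≠ 0 := by rw [h1]; exact one_ne_zero
    exact ⟨hle, mem_of_coeff_ne_zero z h2, (mem_iff hE z).1 hz _ h2⟩
  · exact absurd h1 zero_ne_one

theorem pow_succ_ne_span_mul_pow {E : ℕ → Set ℕ} (hs : s ∈ semigroup479)
    (hI : ∀ n, I ^ n = monomialIdeal k semigroup479 (E n)) {n : ℕ}
    (hE : ∀ e ∈ semigroup479, e ∈ E n → ∀ h ∈ semigroup479, e + h ∈ E n) {e : ℕ}
    (he : e ∈ semigroup479) (heE : e ∈ E (n + 1))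
    (h : ¬ (s ≤ e ∧ e - s ∈ semigroup479 ∧ e - s ∈ E n)) :
    I ^ (n + 1) ≠ Ideal.span {tPow k s hs} * I ^ n := by
  intro heq
  have h1 : tPow k e he ∈ I ^ (n + 1) := by
    rw [hI]
    exact tPow_mem_monomialIdeal he heE
  rw [heq, hI] at h1
  exact h (mem_of_tPow_mem_span_mul hs hE he h1)

theorem isReductionNumber_of_nine (hs : s ∈ semigroup479) (h9 : s = 9)
    (hI : I = monomialIdeal k semigroup479 {n | s ≤ n ∧ n ≠ s + 2}) :
    IsReductionNumber (Ideal.span {tPow k s hs}) I 1 := by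
  have hpow := pow_eq (.inr h9) hI
  refine isReductionNumber_succ (r := 0) (pow_succ_eq_span_mul_pow hs hpow ?_ ?_)
    -- 12 is an exponent of I, but 12 − 9 = 3 ∉ H.
    (pow_succ_ne_span_mul_pow hs hpow (powExp_closed 0) (mem_of_le 12 (by omega)) ?_ ?_)
  · intro b hb hbE
    simp only [mem_semigroup479_iff, powExp, Set.mem_ofPred_eq] at *
    omega
  · intro e he heE
    simp only [mem_semigroup479_iff, powExp, Set.mem_ofPred_eq] at *
    exact ⟨e - s, by omega, by omega, by omega⟩
  · simp only [powExp, Set.mem_ofPred_eq]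
    omega
  · rw [mem_semigroup479_iff]
    omega

theorem isReductionNumber_of_four (hs : s ∈ semigroup479) (h4 : s = 4)
    (hI : I = monomialIdeal k semigroup479 {n | s ≤ n ∧ n ≠ s + 2}) :
    IsReductionNumber (Ideal.span {tPow k s hs}) I 2 := by
  have hpow := pow_eq (.inl h4) hI
  refine isReductionNumber_succ (r := 1) (pow_succ_eq_span_mul_pow hs hpow ?_ ?_)
    -- 14 = 7 + 7, but 14 − 4 = 10 ∉ H.
    (pow_succ_ne_span_mul_pow hs hpow (powExp_closed 1) (mem_of_le 14 (by omega)) ?_ ?_)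
  · intro b hb hbE
    simp only [mem_semigroup479_iff, powExp, Set.mem_ofPred_eq] at *
    omega
  · intro e he heE
    simp only [mem_semigroup479_iff, powExp, Set.mem_ofPred_eq] at *
    exact ⟨e - s, by omega, by omega, by omega⟩
  · simp only [powExp, Set.mem_ofPred_eq]
    omega
  · rw [mem_semigroup479_iff]
    omega

theorem isReductionNumber_of_eight_or_le (hs : s ∈ semigroup479) (h8 : s = 8 ∨ 11 ≤ s)
    (hI : I = monomialIdeal k semigroup479 {n | s ≤ n ∧ n ≠ s + 2}) :
    IsReductionNumber (Ideal.span {tPow k s hs}) I 2 := by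
  have hpow := pow_eq' (.inr h8) hI
  refine isReductionNumber_succ (r := 1) (pow_succ_eq_span_mul_pow hs hpow ?_ ?_)
    -- 2s + 2 = (s + 1) + (s + 1) is an exponent of I², but s + 2 is not one of I.
    (pow_succ_ne_span_mul_pow hs hpow (powExp'_closed 1) (mem_of_le (2 * s + 2) (by omega)) ?_ ?_)
  · intro b hb hbE
    simp only [mem_semigroup479_iff, powExp', Set.mem_ofPred_eq] at *
    omega
  · intro e he heE
    simp only [mem_semigroup479_iff, powExp', Set.mem_ofPred_eq] at *
    exact ⟨e - s, by omega, by omega, by omega⟩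
  · simp only [powExp', Set.mem_ofPred_eq, true_and]
    omega
  · simp only [powExp', Set.mem_ofPred_eq, true_and]
    omega

theorem isReductionNumber_of_seven (hs : s ∈ semigroup479) (h7 : s = 7)
    (hI : I = monomialIdeal k semigroup479 {n | s ≤ n ∧ n ≠ s + 2}) :
    IsReductionNumber (Ideal.span {tPow k s hs}) I 3 := by
  have hpow := pow_eq' (.inl h7) hI
  refine isReductionNumber_succ (r := 2) (pow_succ_eq_span_mul_pow hs hpow ?_ ?_)
    -- 24 = 8 + 8 + 8 is an exponent of I³, but 24 − 7 = 17 is the gap of I².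
    (pow_succ_ne_span_mul_pow hs hpow (powExp'_closed 2) (mem_of_le 24 (by omega)) ?_ ?_)
  · intro b hb hbE
    simp only [mem_semigroup479_iff, powExp', Set.mem_ofPred_eq] at *
    omega
  · intro e he heE
    simp only [mem_semigroup479_iff, powExp', Set.mem_ofPred_eq] at *
    exact ⟨e - s, by omega, by omega, by omega⟩
  · simp only [powExp', Set.mem_ofPred_eq]
    omega
  · simp only [powExp', Set.mem_ofPred_eq, true_and]
    omega

theorem coeff_of_mem (hI : I = monomialIdeal k semigroup479 {n | s ≤ n ∧ n ≠ s + 2}) {f : Ring479 k}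
    (hf : f ∈ I) {n : ℕ}
    (hn : PowerSeries.coeff n (f : PowerSeries k) ≠ 0) : s ≤ n ∧ n ≠ s + 2 := by
  rw [hI, mem_iff] at hf
  · exact hf n hn
  · intro e he heE a ha
    rw [mem_semigroup479_iff] at he ha
    simp only [Set.mem_ofPred_eq] at *
    omega

theorem maximalIdeal_sq_mul_ne (hs : s ∈ semigroup479) (h : s = 8 ∨ s = 11)
    (hI : I = monomialIdeal k semigroup479 {n | s ≤ n ∧ n ≠ s + 2}) :
    maximalIdeal (Ring479 k) ^ 2 * I ≠ maximalIdeal (Ring479 k) ^ 2 * Ideal.span {tPow k s hs} := by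
  intro heq
  have h8 : 8 ∈ semigroup479 := (mem_semigroup479_iff 8).2 (by omega)
  have hs1 : s + 1 ∈ semigroup479 := (mem_semigroup479_iff _).2 (by omega)
  -- The exponent 8 + (s + 1) = s + 9 separates the two ideals: it would lie in 𝔪²Q only if 9 were
  -- an exponent of 𝔪².
  have h1 : tPow k 8 h8 * tPow k (s + 1) hs1 ∈ maximalIdeal (Ring479 k) ^ 2 * I := by
    refine Ideal.mul_mem_mul ?_ ?_
    · rw [maximalIdeal_sq_eq]
      exact tPow_mem_monomialIdeal h8 (by simp)
    · rw [hI]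
      exact tPow_mem_monomialIdeal hs1 (by simp)
  rw [heq, mul_comm (_ ^ 2), maximalIdeal_sq_eq, tPow_mul_tPow] at h1
  have h2 := (mem_of_tPow_mem_span_mul hs ?_ _ h1).2.2
  · simp only [Set.mem_ofPred_eq] at h2
    omega
  · intro e he heE a ha
    rw [mem_semigroup479_iff] at he ha
    simp only [Set.mem_ofPred_eq] at *
    omega

theorem le_maximalIdeal_sq (h11 : 11 ≤ s)
    (hI : I = monomialIdeal k semigroup479 {n | s ≤ n ∧ n ≠ s + 2}) :
    I ≤ maximalIdeal (Ring479 k) ^ 2 := by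
  rw [hI, maximalIdeal_sq_eq]
  refine Ideal.span_mono ?_
  rintro _ ⟨e, he, heE, rfl⟩
  simp only [Set.mem_ofPred_eq] at heE
  exact ⟨e, he, by simp only [Set.mem_ofPred_eq]; omega, rfl⟩

theorem sq_le_span (hs : s ∈ semigroup479) (h11 : 11 ≤ s)
    (hI : I = monomialIdeal k semigroup479 {n | s ≤ n ∧ n ≠ s + 2}) :
    I ^ 2 ≤ Ideal.span {tPow k s hs} := by
  rw [pow_eq' (.inr (.inr h11)) hI]
  refine Ideal.span_le.2 ?_
  rintro _ ⟨e, he, heE, rfl⟩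
  rw [SetLike.mem_coe, mem_span_tPow_iff]
  intro n hn
  rw [coeff_tPow] at hn
  simp only [powExp', Set.mem_ofPred_eq] at heE
  have h1 : n = e := by
    by_contra hne
    exact hn (if_neg hne)
  exact ⟨n - s, mem_of_le _ (by omega), by omega⟩

end Ring479

theorem mainTheorem9 (k : Type*) [Field k] :
    (ringKrullDim (Ring479 k) = 1 ∧ IsCohenMacaulayLocal (Ring479 k) ∧
      ¬ IsGorensteinLocal (Ring479 k)) ∧
    ∀ (s : ℕ) (hs : s ∈ semigroup479), 0 < s →
      ∀ m Q I : Ideal (Ring479 k),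
        m = maximalIdeal (Ring479 k) →
        Q = Ideal.span {semigroupRing.tPow k s hs} →
        I = Q.colon ((m ^ 2 : Ideal (Ring479 k)) : Set (Ring479 k)) →
        ((I : Set (Ring479 k)) ⊆ idealIntegralClosure Q) ∧
        (11 ≤ s → I ≤ m ^ 2 ∧ I ^ 2 ≤ Q) ∧
        (s = 9 → IsReductionNumber Q I 1) ∧
        (s = 4 ∨ s = 8 ∨ 11 ≤ s → IsReductionNumber Q I 2) ∧
        (s = 7 → IsReductionNumber Q I 3) ∧
        (IsCohenMacaulayRing (AssocGradedRing I) ↔ s = 4 ∨ s = 8 ∨ s = 9) ∧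
        (IsCohenMacaulayRing (FiberCone I) ↔ s = 4 ∨ s = 9) ∧
        IsBuchsbaumRing (FiberCone I) ∧
        (IsBuchsbaumRing (AssocGradedRing I) ↔ s ≠ 7) ∧
        (s = 8 ∨ s = 11 → m ^ 2 * I ≠ m ^ 2 * Q) := by
  refine ⟨⟨semigroupRing.ringKrullDim_eq_one (by norm_num) Ring479.four_mem Ring479.mem_of_le,
    semigroupRing.isCohenMacaulayLocal (by norm_num) Ring479.four_mem Ring479.mem_of_le,
    Ring479.not_isGorensteinLocal⟩, ?_⟩
  intro s hs hs0 m Q I hm hQ hI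
  subst hm hQ
  rw [Ring479.colon_eq hs] at hI
  have hcases : s = 4 ∨ s = 7 ∨ s = 8 ∨ s = 9 ∨ 11 ≤ s := by
    have h := (mem_semigroup479_iff s).1 hs
    omega
  have hG : (IsCohenMacaulayRing (AssocGradedRing I) ↔ s = 4 ∨ s = 8 ∨ s = 9) ∧
      (IsBuchsbaumRing (AssocGradedRing I) ↔ s ≠ 7) := by
    rcases hcases with h | h | h | h | h
    · have h1 := Ring479.assocGradedRing_of_four_or_nine hs (.inl h) hI
      exact ⟨iff_of_true h1.1 (by omega), iff_of_true h1.2 (by omega)⟩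
    · have h1 := Ring479.assocGradedRing_of_seven hs h hI
      exact ⟨iff_of_false h1.1 (by omega), iff_of_false h1.2 (by omega)⟩
    · have h1 := Ring479.assocGradedRing_of_eight hs h hI
      exact ⟨iff_of_true h1.1 (by omega), iff_of_true h1.2 (by omega)⟩
    · have h1 := Ring479.assocGradedRing_of_four_or_nine hs (.inr h) hI
      exact ⟨iff_of_true h1.1 (by omega), iff_of_true h1.2 (by omega)⟩
    · have h1 := Ring479.assocGradedRing_of_le hs h hI
      exact ⟨iff_of_false h1.1 (by omega), iff_of_true h1.2 (by omega)⟩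
  have hF : (IsCohenMacaulayRing (FiberCone I) ↔ s = 4 ∨ s = 9) ∧
      IsBuchsbaumRing (FiberCone I) := by
    by_cases h4 : s = 4
    · have h1 := Ring479.fiberCone_of_four hs h4 hI
      exact ⟨iff_of_true h1.1 (by omega), h1.2⟩
    by_cases h9 : s = 9
    · have h1 := Ring479.fiberCone_of_nine hs h9 hI
      exact ⟨iff_of_true h1.1 (by omega), h1.2⟩
    have h1 := Ring479.fiberCone_of_other hs (by omega) hI
    exact ⟨iff_of_false h1.1 (by omega), h1.2⟩
  refine ⟨fun f hf => ?_, fun h => ⟨Ring479.le_maximalIdeal_sq h hI, Ring479.sq_le_span hs h hI⟩,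
    fun h => Ring479.isReductionNumber_of_nine hs h hI, fun h => ?_,
    fun h => Ring479.isReductionNumber_of_seven hs h hI, hG.1, hF.1, hF.2, hG.2,
    fun h => Ring479.maximalIdeal_sq_mul_ne hs h hI⟩
  · exact semigroupRing.isIntegralOverIdeal_of_le (by norm_num) Ring479.four_mem
      Ring479.mem_of_le hs fun n hn => (Ring479.coeff_of_mem hI hf hn).1
  · rcases h with h | h
    · exact Ring479.isReductionNumber_of_four hs h hI
    · exact Ring479.isReductionNumber_of_eight_or_le hs h hI
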